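/- **Theorem (polynomial-time approximation scheme for free-block machine packing with constant $k$).** *Model.* Fix $k$. An unlimited supply of identical machines with $k$ processors each is available. An instance is a finite list of jobs; job $j$ has a nonnegative rational demand $d_j$ and a nondecreasing execution table $f_j : \{1,\dots,k\} \to \mathbb{Q}_{\ge 0}$. On each machine one may form arbitrary blocks of processors (block sizes between $1$ and $k$ with sum at most $k$), each block being dedicated to one job; a block of size $p$ dedicated to $j$ satisfies $f_j(p)$ units of the demand of $j$. A placement is feasible if, for every job $j$, the amount satisfied over all blocks on all machines is at least $d_j$. Its cost is the number of machines on which some job is placed, and $\textsc{opt}$ is the minimum cost of a feasible placement. Numbers are written in binary; a placement is output as a list of pairs (multiplicity, contents of a machine). *Claim.* For every constant $k$ and every $\varepsilon > 0$ there is an algorithm which runs in time polynomial in the length of the input (the polynomial may depend on $k$ and $\varepsilon$) and which, on every instance that has a feasible placement, outputs a feasible placement with at most $(1+\varepsilon)\,\textsc{opt}$ machines. -/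

import Mathlib

namespace ServerPlacement

/-! ### The free-block machine packing problem with `k` processors per machine -/

/-- A job: its demand and its execution table. The entry `exec i` is the amount of demand that is
satisfied by one block of `i + 1` processors; larger blocks satisfy at least as much. -/
structure Job (k : ℕ) where
  demand : ℚ≥0
  exec : Fin k → ℚ≥0
  exec_mono : Monotone exec

/-- An instance is a finite list of jobs (machines are identical and there are as many as needed). -/
abbrev Packing (k : ℕ) : Type := List (Job k)

/-- A block on some machine: the job it is dedicated to, and its number of processors, which
is `idx + 1`. Hence block sizes range over `1, …, k`. -/
structure Block (n k : ℕ) where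
  job : Fin n
  idx : Fin k

/-- The number of processors in a block. -/
def Block.size {n k : ℕ} (b : Block n k) : ℕ := (b.idx : ℕ) + 1

/-- What is placed on one machine: the blocks into which its used processors are grouped. In the
free-block model any grouping is permitted as long as the machine has enough processors. -/
abbrev Machine (n k : ℕ) : Type := List (Block n k)

/-- The blocks of a machine use at most its `k` processors. -/
def Machine.Fits {n k : ℕ} (M : Machine n k) : Prop := (M.map Block.size).sum ≤ k

/-- A placement lists the contents of all machines. -/
abbrev Placement (n k : ℕ) : Type := List (Machine n k)

/-- The demand of job `j` satisfied by a block (zero if the block is dedicated to another job). -/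
def Packing.blockAmount {k : ℕ} (I : Packing k) (j : Fin I.length) (b : Block I.length k) : ℚ≥0 :=
  if b.job = j then (I.get j).exec b.idx else 0

/-- The total demand of job `j` that is satisfied over all machines. -/
def Packing.amount {k : ℕ} (I : Packing k) (j : Fin I.length) (P : Placement I.length k) : ℚ≥0 :=
  (P.map fun M => (M.map (I.blockAmount j)).sum).sum

/-- A placement is feasible if no machine is overfull and every demand is satisfied. -/
def Packing.Feasible {k : ℕ} (I : Packing k) (P : Placement I.length k) : Prop :=
  (∀ M ∈ P, M.Fits) ∧ ∀ j : Fin I.length, (I.get j).demand ≤ I.amount j P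

/-- The number of machines on which some job is placed. -/
def Placement.cost {n k : ℕ} (P : Placement n k) : ℕ := P.countP fun M => !M.isEmpty

/-- Some placement satisfies all demands (this fails only if a job has positive demand but an
execution table that is identically zero). -/
def Packing.Solvable {k : ℕ} (I : Packing k) : Prop := ∃ P, I.Feasible P

/-- The minimum number of machines of a feasible placement (meaningful for solvable instances). -/
noncomputable def Packing.opt {k : ℕ} (I : Packing k) : ℕ :=
  sInf {m | ∃ P, I.Feasible P ∧ Placement.cost P = m}

/-- A placement written compactly: `(a, M)` stands for `a` machines with the contents `M`. As
demands are written in binary, the number of machines may be exponential in the input length. -/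
abbrev Schedule (n k : ℕ) : Type := List (ℕ × Machine n k)

/-- The placement described by a compact schedule. -/
def Schedule.expand {n k : ℕ} (S : Schedule n k) : Placement n k :=
  S.flatMap fun e => List.replicate e.1 e.2

/-! ### Programs and their running time

A deterministic programming language over S-expressions whose atoms are natural numbers. Time is
measured by the logarithmic cost criterion: every operation is charged for all the bits of its
operand and of its result, so that running times agree with those of Turing machines up to a
polynomial. -/

/-- S-expressions over the natural numbers. -/
inductive Data : Type
  | atom (n : ℕ) : Data
  | pair (a b : Data) : Data

namespace Data

/-- The length of an S-expression, with atoms written in binary. -/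
def size : Data → ℕ
  | atom n => Nat.size n + 1
  | pair a b => a.size + b.size + 1

/-- Every S-expression other than the atom `0` counts as true. -/
def truth : Data → Bool
  | atom 0 => false
  | _ => true

end Data

/-- The elementary operations. -/
inductive Op : Type
  | id
  | const (n : ℕ)
  | fst
  | snd
  | add
  | sub
  | mul
  | div

/-- The effect of the elementary operations. The arithmetic operations expect a pair of atoms
(subtraction is truncated, division rounds down and division by zero is zero); operations on an
argument of the wrong shape return the atom `0`. -/
def Op.apply : Op → Data → Data
  | .id, x => x
  | .const n, _ => .atom n
  | .fst, .pair a _ => a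
  | .snd, .pair _ b => b
  | .add, .pair (.atom m) (.atom n) => .atom (m + n)
  | .sub, .pair (.atom m) (.atom n) => .atom (m - n)
  | .mul, .pair (.atom m) (.atom n) => .atom (m * n)
  | .div, .pair (.atom m) (.atom n) => .atom (m / n)
  | _, _ => .atom 0

/-- Programs, which transform one S-expression into another. -/
inductive Prog : Type
  /-- apply an elementary operation -/
  | op (o : Op) : Prog
  /-- run `p`, then run `q` on the result -/
  | seq (p q : Prog) : Prog
  /-- run `p` and `q` on copies of the argument and form the pair of the results -/
  | pair (p q : Prog) : Prog
  /-- run `p` if the test `c` yields true on a copy of the argument, and `q` otherwise -/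
  | ite (c p q : Prog) : Prog
  /-- repeat `p` as long as the test `c` yields true on a copy of the current value -/
  | loop (c p : Prog) : Prog

/-- `Runs p x y t`: on the argument `x` the program `p` halts with result `y` after time `t`. -/
inductive Runs : Prog → Data → Data → ℕ → Prop
  | op (o : Op) (x : Data) : Runs (.op o) x (o.apply x) (x.size + (o.apply x).size)
  | seq {p q : Prog} {x y z : Data} {s t : ℕ} :
      Runs p x y s → Runs q y z t → Runs (.seq p q) x z (x.size + s + t)
  | pair {p q : Prog} {x y z : Data} {s t : ℕ} :
      Runs p x y s → Runs q x z t → Runs (.pair p q) x (.pair y z) (x.size + s + t)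
  | ite_true {c p q : Prog} {x b y : Data} {s t : ℕ} :
      Runs c x b s → b.truth = true → Runs p x y t → Runs (.ite c p q) x y (x.size + s + t)
  | ite_false {c p q : Prog} {x b y : Data} {s t : ℕ} :
      Runs c x b s → b.truth = false → Runs q x y t → Runs (.ite c p q) x y (x.size + s + t)
  | loop_done {c p : Prog} {x b : Data} {s : ℕ} :
      Runs c x b s → b.truth = false → Runs (.loop c p) x x (x.size + s)
  | loop_step {c p : Prog} {x b y z : Data} {s t u : ℕ} :
      Runs c x b s → b.truth = true → Runs p x y t → Runs (.loop c p) y z u →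
      Runs (.loop c p) x z (x.size + s + t + u)

/-- Programs are deterministic: result and running time are determined by the argument. -/
theorem Runs.det {p : Prog} {x y : Data} {t : ℕ} (h : Runs p x y t) :
    ∀ {y' : Data} {t' : ℕ}, Runs p x y' t' → y = y' ∧ t = t' := by
  induction h with
  | op o x => intro y' t' h; cases h; exact ⟨rfl, rfl⟩
  | seq _ _ ih₁ ih₂ =>
    intro y' t' h
    cases h with
    | seq a b => obtain ⟨rfl, rfl⟩ := ih₁ a; obtain ⟨rfl, rfl⟩ := ih₂ b; exact ⟨rfl, rfl⟩
  | pair _ _ ih₁ ih₂ =>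
    intro y' t' h
    cases h with
    | pair a b => obtain ⟨rfl, rfl⟩ := ih₁ a; obtain ⟨rfl, rfl⟩ := ih₂ b; exact ⟨rfl, rfl⟩
  | ite_true _ hb _ ih₁ ih₂ =>
    intro y' t' h
    cases h with
    | ite_true a _ b => obtain ⟨rfl, rfl⟩ := ih₁ a; obtain ⟨rfl, rfl⟩ := ih₂ b; exact ⟨rfl, rfl⟩
    | ite_false a hb' _ => obtain ⟨rfl, rfl⟩ := ih₁ a; simp [hb] at hb'
  | ite_false _ hb _ ih₁ ih₂ =>
    intro y' t' h
    cases h with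
    | ite_true a hb' _ => obtain ⟨rfl, rfl⟩ := ih₁ a; simp [hb] at hb'
    | ite_false a _ b => obtain ⟨rfl, rfl⟩ := ih₁ a; obtain ⟨rfl, rfl⟩ := ih₂ b; exact ⟨rfl, rfl⟩
  | loop_done _ hb ih₁ =>
    intro y' t' h
    cases h with
    | loop_done a _ => obtain ⟨rfl, rfl⟩ := ih₁ a; exact ⟨rfl, rfl⟩
    | loop_step a hb' _ _ => obtain ⟨rfl, rfl⟩ := ih₁ a; simp [hb] at hb'
  | loop_step _ hb _ _ ih₁ ih₂ ih₃ =>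
    intro y' t' h
    cases h with
    | loop_done a hb' => obtain ⟨rfl, rfl⟩ := ih₁ a; simp [hb] at hb'
    | loop_step a _ b c =>
      obtain ⟨rfl, rfl⟩ := ih₁ a; obtain ⟨rfl, rfl⟩ := ih₂ b; obtain ⟨rfl, rfl⟩ := ih₃ c
      exact ⟨rfl, rfl⟩

/-! ### Input and output formats -/

/-- Lists are written as nested pairs that end in the atom `0`. -/
def encodeList {α : Type} (enc : α → Data) : List α → Data
  | [] => .atom 0
  | a :: l => .pair (enc a) (encodeList enc l)

/-- Rational numbers are written as reduced fractions. -/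
def encodeRat (q : ℚ≥0) : Data := .pair (.atom q.num) (.atom q.den)

/-- A job is written as its demand followed by its execution table. -/
def Job.encode {k : ℕ} (j : Job k) : Data :=
  .pair (encodeRat j.demand) (encodeList encodeRat (List.ofFn j.exec))

/-- An instance is written as the list of its jobs. -/
def Packing.encode {k : ℕ} (I : Packing k) : Data := encodeList Job.encode I

/-- A block is written as the number of its job (counted from zero) and its size. -/
def Block.encode {n k : ℕ} (b : Block n k) : Data := .pair (.atom b.job) (.atom b.size)

/-- A compact schedule is written as the list of its entries: multiplicity and machine contents. -/
def Schedule.encode {n k : ℕ} (S : Schedule n k) : Data :=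
  encodeList (fun e : ℕ × Machine n k => .pair (.atom e.1) (encodeList Block.encode e.2)) S

/-- The program `p` is a polynomial-time approximation algorithm with ratio `r` for the free-block
packing problem on machines with `k` processors: its running time on every instance is bounded by a
polynomial in the input length, and on every solvable instance its output is a schedule that
satisfies all demands on at most `r` times the optimal number of machines. -/
def IsPolyTimeApprox (k : ℕ) (r : ℝ) (p : Prog) : Prop :=
  ∃ q : Polynomial ℕ, ∀ I : Packing k, ∃ (out : Data) (t : ℕ),
    Runs p I.encode out t ∧ t ≤ q.eval I.encode.size ∧
    (I.Solvable → ∃ S : Schedule I.length k, out = S.encode ∧ I.Feasible S.expand ∧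
      (Placement.cost S.expand : ℝ) ≤ r * (I.opt : ℝ))

end ServerPlacement

/-! For constant `k`, what matters about a partly filled collection of `M` machines is how many of
them have `r` unused processors, for each `r ≤ k`. There are at most `(M + 1) ^ (k + 1)` such
profiles. If `M` is linear in the number `n` of jobs, an exact dynamic program is therefore
polynomial: treat the jobs one at a time, add blocks for the current job, and keep for each profile
only the partial placement that gives this job the most (`prune`). Once its demand is met, the
amount is forgotten. A profile is stored as a numeral in base `M + 1` whose leading digit counts the
untouched machines, so the largest key in the final table belongs to the cheapest placement
(`best_table`).

The optimum may be exponential in the input length, so machines are used in bundles of `u` equal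
ones. Let `coarse` be the number of machines needed if every block is a full machine. It is at least
the optimum and at most `k` times the optimum (`opt_le_coarse`, `coarse_le`). Take `u` to be about
`coarse / (E * n)` for a large constant `E`. By `exists_rounding` an optimal placement can be
replaced by `u` copies of a placement `Q` at the price of `(C + n * k) * u` further machines, where
`C` is the constant number of machine shapes. This price is at most `(C + k) * coarse / E`, hence at
most `ε * opt`, and `Q` itself has only `O(n)` machines, so the dynamic program can find something
as good (`scheme_spec`). If `coarse < E * n`, then `u = 1` and the result is optimal.

The running time is obtained from closure properties of the class `PT`. The main one is iteration
over a list under an invariant that keeps the intermediate values short (`PT.foldl_of_inv`); for the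
dynamic program the invariant is `GoodTable`. -/

namespace ServerPlacement

/-! ### Polynomial-time computable functions -/

/-- Types whose elements are written as S-expressions. -/
class Enc (α : Type) where
  enc : α → Data

open Enc

instance : Enc ℕ := ⟨Data.atom⟩
instance {α β : Type} [Enc α] [Enc β] : Enc (α × β) := ⟨fun x => .pair (enc x.1) (enc x.2)⟩
instance {α : Type} [Enc α] : Enc (List α) := ⟨encodeList enc⟩
instance : Enc ℚ≥0 := ⟨encodeRat⟩
instance {k : ℕ} : Enc (Job k) := ⟨Job.encode⟩

/-- The length of the encoding. -/
def len {α : Type} [Enc α] (a : α) : ℕ := (enc a).size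

section
variable {α β γ δ σ : Type} [Enc α] [Enc β] [Enc γ] [Enc δ] [Enc σ]

@[simp] theorem len_nat (n : ℕ) : len n = Nat.size n + 1 := rfl
@[simp] theorem len_pair (a : α) (b : β) : len (a, b) = len a + len b + 1 := rfl
@[simp] theorem len_nil : len ([] : List α) = 1 := by simp [len, enc, encodeList, Data.size]
@[simp] theorem len_cons (a : α) (l : List α) : len (a :: l) = len a + len l + 1 := rfl

theorem Data.one_le_size (x : Data) : 1 ≤ x.size := by cases x <;> simp [Data.size]
theorem one_le_len (a : α) : 1 ≤ len a := Data.one_le_size _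

theorem length_le_len (l : List α) : l.length ≤ len l := by
  induction l with
  | nil => simp
  | cons a l ih => simp; omega

theorem len_le_of_mem {a : α} {l : List α} (h : a ∈ l) : len a ≤ len l := by
  induction l with
  | nil => simp at h
  | cons b l ih =>
    rcases List.mem_cons.1 h with rfl | h
    · simp; omega
    · have := ih h; simp; omega

theorem len_append (l m : List α) : len (l ++ m) + 1 = len l + len m := by
  induction l with
  | nil => simp; omega
  | cons a l ih => simp; omega

theorem len_list_le {l : List α} {m b : ℕ} (hm : l.length ≤ m) (hb : ∀ a ∈ l, len a ≤ b) :
    len l ≤ m * (b + 1) + 1 := by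
  have : len l ≤ l.length * (b + 1) + 1 := by
    clear hm
    induction l with
    | nil => simp
    | cons a l ih =>
      have h1 := ih fun x hx => hb x (List.mem_cons_of_mem _ hx)
      have h2 := hb a List.mem_cons_self
      simp only [len_cons, List.length_cons, Nat.add_one_mul]; omega
  exact this.trans (by gcongr)

theorem Runs.size_le {p : Prog} {x y : Data} {t : ℕ} (h : Runs p x y t) : y.size ≤ t := by
  induction h with
  | op o x => omega
  | pair _ _ => rename_i x _ _ _ _ _ _ _ _; have := x.one_le_size; simp [Data.size]; omega
  | _ => omega

theorem poly_mono (q : Polynomial ℕ) {m n : ℕ} (h : m ≤ n) : q.eval m ≤ q.eval n := by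
  induction q using Polynomial.induction_on' with
  | add p q hp hq => simpa using add_le_add hp hq
  | monomial i a => simpa using Nat.mul_le_mul_left _ (Nat.pow_le_pow_left h i)

/-- Functions that are bounded by a polynomial in the length of the argument. -/
def PolyBdd (f : α → ℕ) : Prop := ∃ q : Polynomial ℕ, ∀ a, f a ≤ q.eval (len a)

theorem PolyBdd.mono {f g : α → ℕ} (hg : PolyBdd g) (h : ∀ a, f a ≤ g a) : PolyBdd f :=
  hg.imp fun _ hq a => (h a).trans (hq a)

theorem PolyBdd.const (c : ℕ) : PolyBdd fun _ : α => c := ⟨Polynomial.C c, by simp⟩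

theorem PolyBdd.self : PolyBdd fun a : α => len a := ⟨Polynomial.X, by simp⟩

theorem PolyBdd.add {f g : α → ℕ} (hf : PolyBdd f) (hg : PolyBdd g) :
    PolyBdd fun a => f a + g a := by
  obtain ⟨p, hp⟩ := hf; obtain ⟨q, hq⟩ := hg
  exact ⟨p + q, fun a => by simpa using add_le_add (hp a) (hq a)⟩

theorem PolyBdd.mul {f g : α → ℕ} (hf : PolyBdd f) (hg : PolyBdd g) :
    PolyBdd fun a => f a * g a := by
  obtain ⟨p, hp⟩ := hf; obtain ⟨q, hq⟩ := hg
  exact ⟨p * q, fun a => by simpa using Nat.mul_le_mul (hp a) (hq a)⟩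

theorem PolyBdd.pow {f : α → ℕ} (hf : PolyBdd f) (n : ℕ) : PolyBdd fun a => f a ^ n := by
  obtain ⟨p, hp⟩ := hf
  exact ⟨p ^ n, fun a => by simpa using Nat.pow_le_pow_left (hp a) n⟩

theorem PolyBdd.poly {f : α → ℕ} (hf : PolyBdd f) (q : Polynomial ℕ) :
    PolyBdd fun a => q.eval (f a) := by
  obtain ⟨p, hp⟩ := hf
  exact ⟨q.comp p, fun a => by simpa using poly_mono q (hp a)⟩

/-- Functions that are computed by a program in polynomial time. -/
@[fun_prop]
def PT (f : α → β) : Prop :=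
  ∃ p : Prog, ∃ q : Polynomial ℕ, ∀ a, ∃ t, Runs p (enc a) (enc (f a)) t ∧ t ≤ q.eval (len a)

theorem PT.of_bdd {f : α → β} (p : Prog) {b : α → ℕ} (hb : PolyBdd b)
    (h : ∀ a, ∃ t, Runs p (enc a) (enc (f a)) t ∧ t ≤ b a) : PT f := by
  obtain ⟨q, hq⟩ := hb
  exact ⟨p, q, fun a => (h a).imp fun t ht => ⟨ht.1, ht.2.trans (hq a)⟩⟩

/-- Writing the result is charged for, so the running time bounds the length of the result. This is
what makes `PT` closed under composition. -/
theorem PT.bdd {f : α → β} (hf : PT f) : PolyBdd fun a => len (f a) := by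
  obtain ⟨p, q, h⟩ := hf
  exact ⟨q, fun a => by obtain ⟨t, ht, hq⟩ := h a; exact ht.size_le.trans hq⟩

theorem PT.of_op {f : α → β} (o : Op) (h : ∀ a, o.apply (enc a) = enc (f a))
    (hb : PolyBdd fun a => len (f a)) : PT f :=
  .of_bdd (b := fun a => len a + len (f a)) (.op o) (PolyBdd.self.add hb) fun a => by
    have := Runs.op o (enc a)
    rw [h] at this
    exact ⟨_, this, le_rfl⟩

@[fun_prop] theorem PT.id : PT fun a : α => a := .of_op .id (fun _ => rfl) .self

@[fun_prop] theorem PT.comp {g : β → γ} {f : α → β} (hg : PT g) (hf : PT f) :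
    PT fun a => g (f a) := by
  have hb := hf.bdd
  obtain ⟨p, q, h⟩ := hf
  obtain ⟨p', q', h'⟩ := hg
  refine .of_bdd (.seq p p') ((PolyBdd.self.add ⟨q, fun _ => le_rfl⟩).add (hb.poly q'))
    fun a => ?_
  obtain ⟨t, ht, hq⟩ := h a
  obtain ⟨t', ht', hq'⟩ := h' (f a)
  exact ⟨_, .seq ht ht', by gcongr; rfl⟩

@[fun_prop] theorem PT.prodMk {f : α → β} {g : α → γ} (hf : PT f) (hg : PT g) :
    PT fun a => (f a, g a) := by
  obtain ⟨p, q, h⟩ := hf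
  obtain ⟨p', q', h'⟩ := hg
  refine .of_bdd (.pair p p') ((PolyBdd.self.add ⟨q, fun _ => le_rfl⟩).add ⟨q', fun _ => le_rfl⟩)
    fun a => ?_
  obtain ⟨t, ht, hq⟩ := h a
  obtain ⟨t', ht', hq'⟩ := h' a
  exact ⟨_, .pair ht ht', by gcongr; rfl⟩

theorem exists_prog_const (d : Data) : ∃ p, ∃ c, ∀ x : Data, ∃ t, Runs p x d t ∧
    t ≤ c * x.size + c := by
  induction d with
  | atom n =>
    exact ⟨.op (.const n), n.size + 1, fun x => ⟨_, .op _ x, by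
      have := x.one_le_size; simp [Op.apply, Data.size]; nlinarith⟩⟩
  | pair a b iha ihb =>
    obtain ⟨p, c, h⟩ := iha
    obtain ⟨p', c', h'⟩ := ihb
    refine ⟨.pair p p', c + c' + 1, fun x => ?_⟩
    obtain ⟨t, ht, hq⟩ := h x
    obtain ⟨t', ht', hq'⟩ := h' x
    exact ⟨_, .pair ht ht', by linarith⟩

@[fun_prop] theorem PT.const (b : β) : PT fun _ : α => b := by
  obtain ⟨p, c, h⟩ := exists_prog_const (enc b)
  exact .of_bdd p ((((PolyBdd.const c).mul .self)).add (.const c)) fun a => h (enc a)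

theorem PT.fst_aux : PT fun x : α × β => x.1 :=
  .of_op .fst (fun _ => rfl) (PolyBdd.self.mono fun x => by
    obtain ⟨a, b⟩ := x; simp; omega)

theorem PT.snd_aux : PT fun x : α × β => x.2 :=
  .of_op .snd (fun _ => rfl) (PolyBdd.self.mono fun x => by
    obtain ⟨a, b⟩ := x; simp; omega)

@[fun_prop] theorem PT.fst {f : α → β × γ} (hf : PT f) : PT fun a => (f a).1 := fst_aux.comp hf
@[fun_prop] theorem PT.snd {f : α → β × γ} (hf : PT f) : PT fun a => (f a).2 := snd_aux.comp hf

/-! ### Arithmetic and case distinctions in polynomial time -/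

/-- The hypothesis is chosen so that it covers both `m + n` (up to equality for products of zero)
and `m * n`. -/
theorem size_le_add {m n c : ℕ} (h : c < (m + 1) * (n + 1)) :
    Nat.size c ≤ Nat.size m + Nat.size n := by
  rw [Nat.size_le, pow_add]
  exact h.trans_le (Nat.mul_le_mul (Nat.lt_size_self m) (Nat.lt_size_self n))

@[fun_prop] theorem PT.add {f g : α → ℕ} (hf : PT f) (hg : PT g) : PT fun a => f a + g a := by
  have : PT fun x : ℕ × ℕ => x.1 + x.2 := .of_op .add (fun _ => rfl)
    (PolyBdd.self.mono fun x => by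
      obtain ⟨m, n⟩ := x
      have := @size_le_add m n (m + n) (by nlinarith)
      simp; omega)
  exact this.comp (hf.prodMk hg)

@[fun_prop] theorem PT.mul {f g : α → ℕ} (hf : PT f) (hg : PT g) : PT fun a => f a * g a := by
  have : PT fun x : ℕ × ℕ => x.1 * x.2 := .of_op .mul (fun _ => rfl)
    (PolyBdd.self.mono fun x => by
      obtain ⟨m, n⟩ := x
      have := @size_le_add m n (m * n) (by nlinarith)
      simp; omega)
  exact this.comp (hf.prodMk hg)

@[fun_prop] theorem PT.sub {f g : α → ℕ} (hf : PT f) (hg : PT g) : PT fun a => f a - g a := by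
  have : PT fun x : ℕ × ℕ => x.1 - x.2 := .of_op .sub (fun _ => rfl)
    (PolyBdd.self.mono fun x => by
      obtain ⟨m, n⟩ := x
      have := Nat.size_le_size (Nat.sub_le m n)
      simp; omega)
  exact this.comp (hf.prodMk hg)

@[fun_prop] theorem PT.div {f g : α → ℕ} (hf : PT f) (hg : PT g) : PT fun a => f a / g a := by
  have : PT fun x : ℕ × ℕ => x.1 / x.2 := .of_op .div (fun _ => rfl)
    (PolyBdd.self.mono fun x => by
      obtain ⟨m, n⟩ := x
      have := Nat.size_le_size (Nat.div_le_self m n)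
      simp; omega)
  exact this.comp (hf.prodMk hg)

@[fun_prop] theorem PT.pow {f : α → ℕ} (hf : PT f) (n : ℕ) : PT fun a => f a ^ n := by
  induction n with
  | zero => simpa using PT.const 1
  | succ n ih => simpa only [pow_succ] using ih.mul hf

theorem PT.sum {ι : Type} (s : Finset ι) {f : ι → α → ℕ} (hf : ∀ i, PT (f i)) :
    PT fun a => ∑ i ∈ s, f i a := by
  classical
  induction s using Finset.induction_on with
  | empty => simpa using PT.const 0
  | insert i s hi ih => simpa only [Finset.sum_insert hi] using (hf i).add ih

theorem PT.prod {ι : Type} (s : Finset ι) {f : ι → α → ℕ} (hf : ∀ i, PT (f i)) :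
    PT fun a => ∏ i ∈ s, f i a := by
  classical
  induction s using Finset.induction_on with
  | empty => simpa using PT.const 1
  | insert i s hi ih => simpa only [Finset.prod_insert hi] using (hf i).mul ih

theorem PT.ite_ne_zero {c : α → ℕ} {f g : α → β} (hc : PT c) (hf : PT f) (hg : PT g) :
    PT fun a => if c a ≠ 0 then f a else g a := by
  obtain ⟨p, q, h⟩ := hf
  obtain ⟨p', q', h'⟩ := hg
  obtain ⟨p'', q'', h''⟩ := hc
  refine .of_bdd (.ite p'' p p') (((PolyBdd.self.add ⟨q'', fun _ => le_rfl⟩).add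
    ⟨q, fun _ => le_rfl⟩).add ⟨q', fun _ => le_rfl⟩) fun a => ?_
  obtain ⟨t, ht, hq⟩ := h a
  obtain ⟨t', ht', hq'⟩ := h' a
  obtain ⟨t'', ht'', hq''⟩ := h'' a
  have hl : (enc a).size = len a := rfl
  rcases hca : c a with _ | n
  · rw [hca] at ht''
    simp only [ne_eq, not_true_eq_false, if_false]
    exact ⟨_, .ite_false ht'' rfl ht', by omega⟩
  · rw [hca] at ht''
    simp only [ne_eq, Nat.succ_ne_zero, not_false_eq_true, if_true]
    exact ⟨_, .ite_true ht'' rfl ht, by omega⟩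

theorem PT.ite_le {c d : α → ℕ} {f g : α → β} (hc : PT c) (hd : PT d) (hf : PT f) (hg : PT g) :
    PT fun a => if c a ≤ d a then f a else g a := by
  -- Truncated subtraction serves as the comparison: `c - d` is nonzero exactly if `c > d`.
  have := PT.ite_ne_zero (hc.sub hd) hg hf
  convert this using 2 with a
  by_cases h : c a ≤ d a
  · simp [h]
  · have : c a - d a ≠ 0 := by omega
    simp [h, this]

theorem PT.ite_eq {c d : α → ℕ} {f g : α → β} (hc : PT c) (hd : PT d) (hf : PT f) (hg : PT g) :
    PT fun a => if c a = d a then f a else g a := by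
  have := PT.ite_le hc hd (PT.ite_le hd hc hf hg) hg
  convert this using 2 with a
  split_ifs <;> first | rfl | omega

/-! ### Lists and iteration over lists -/

@[fun_prop] theorem PT.cons {f : α → β} {g : α → List β} (hf : PT f) (hg : PT g) :
    PT fun a => f a :: g a := by
  have : PT fun x : β × List β => x.1 :: x.2 := by
    -- A nonempty list and the pair of its head and tail have the same encoding, so the identity
    -- program does the work.
    obtain ⟨p, q, h⟩ := PT.id (α := β × List β)
    exact ⟨p, q, h⟩
  exact this.comp (hf.prodMk hg)

/-- Iteration over a list. The remaining list and the intermediate value satisfy an invariant, which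
has to bound the length of the value by a polynomial. -/
theorem PT.foldl_of_inv {l : α → List β} {start : α → σ} {step : α → σ → β → σ} {b : α → ℕ}
    (hl : PT l) (hs : PT start) (hstep : PT fun x : α × σ × β => step x.1 x.2.1 x.2.2)
    (inv : α → List β → σ → Prop) (h0 : ∀ a, inv a (l a) (start a))
    (hinv : ∀ a s x m, inv a (x :: m) s → x :: m <:+ l a → inv a m (step a s x))
    (hb : PolyBdd b) (hlen : ∀ a m s, inv a m s → len s ≤ b a) :
    PT fun a => (l a).foldl (step a) (start a) := by
  -- The loop body runs only on a nonempty remaining list, which it may read as a pair of head and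
  -- tail.
  have hbody : PT fun x : α × (β × List β) × σ => (x.1, x.2.1.2, step x.1 x.2.2 x.2.1.1) :=
    PT.fst_aux.prodMk (PT.prodMk (by fun_prop)
      (hstep.comp (g := fun x : α × σ × β => step x.1 x.2.1 x.2.2)
        (f := fun x : α × (β × List β) × σ => (x.1, x.2.2, x.2.1.1)) (by fun_prop)))
  obtain ⟨p, q, hp⟩ := hbody
  -- The remaining list is its own loop test: only the empty list is encoded by the atom `0`.
  have htest : PT fun x : α × List β × σ => x.2.1 := by fun_prop
  obtain ⟨c, qc, hc⟩ := htest
  set Z : α → ℕ := fun a => len a + len (l a) + b a + 2 with hZ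
  have hZb : PolyBdd Z := ((PolyBdd.self.add hl.bdd).add hb).add (.const 2)
  set T : α → ℕ := fun a => Z a + qc.eval (Z a) + q.eval (Z a) with hT
  have hTb : PolyBdd T := (hZb.add (hZb.poly qc)).add (hZb.poly q)
  have key : ∀ a, ∀ m : List β, m <:+ l a → ∀ s, inv a m s → ∃ t,
      Runs (.loop c p) (enc (a, m, s)) (enc (a, ([] : List β), m.foldl (step a) s)) t ∧
      t ≤ (m.length + 1) * T a := by
    intro a m
    induction m with
    | nil =>
      intro _ s hsi
      obtain ⟨t, ht, hqt⟩ := hc (a, [], s)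
      have h1 : len (a, ([] : List β), s) ≤ Z a := by
        have := hlen a _ s hsi
        have := one_le_len (l a)
        simp [hZ]; omega
      refine ⟨_, .loop_done ht rfl, ?_⟩
      have h2 := hqt.trans (poly_mono qc h1)
      have h3 : (enc (a, ([] : List β), s)).size = len (a, ([] : List β), s) := rfl
      simp [hT]; omega
    | cons x m ih =>
      intro hm s hsi
      obtain ⟨t, ht, hqt⟩ := hc (a, x :: m, s)
      obtain ⟨t', ht', hqt'⟩ := hp (a, (x, m), s)
      obtain ⟨t'', ht'', hqt''⟩ := ih ((List.suffix_cons x m).trans hm) _ (hinv a s x m hsi hm)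
      have h1 : len (a, x :: m, s) ≤ Z a := by
        have h1 := hlen a _ s hsi
        obtain ⟨m', hm'⟩ := hm
        have h2 := len_append m' (x :: m)
        rw [hm'] at h2
        have := one_le_len m'
        rw [len_pair, len_pair]; simp only [hZ]; omega
      refine ⟨_, .loop_step ht rfl ht' ht'', ?_⟩
      have h2 := hqt.trans (poly_mono qc h1)
      have h3 : (enc (a, x :: m, s)).size = len (a, x :: m, s) := rfl
      have h4 := hqt'.trans (poly_mono q h1)
      rw [List.length_cons, Nat.add_one_mul]
      simp only [hT] at hqt'' ⊢
      omega
  have hcomp : PT fun a => (a, l a, start a) := by fun_prop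
  obtain ⟨p0, q0, hp0⟩ := hcomp
  have hfold : PT fun a => (a, ([] : List β), (l a).foldl (step a) (start a)) := by
    refine .of_bdd (.seq p0 (.loop c p)) ((PolyBdd.self.add ⟨q0, fun _ => le_rfl⟩).add
      ((hl.bdd.add (.const 1)).mul hTb)) fun a => ?_
    obtain ⟨t, ht, hqt⟩ := hp0 a
    obtain ⟨t', ht', hqt'⟩ := key a (l a) List.suffix_rfl (start a) (h0 a)
    refine ⟨_, .seq ht ht', ?_⟩
    have : ((l a).length + 1) * T a ≤ (len (l a) + 1) * T a := by
      gcongr; exact length_le_len _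
    have h3 : (enc a).size = len a := rfl
    omega
  exact hfold.snd.snd

/-- Iteration over a list, where each step lengthens the current value by an amount that is
polynomial in the length of the context and of the list element. -/
theorem PT.foldl {l : α → List β} {start : α → σ} {step : α → σ → β → σ} {b : α × β → ℕ}
    (hl : PT l) (hs : PT start) (hstep : PT fun x : α × σ × β => step x.1 x.2.1 x.2.2)
    (hb : PolyBdd b) (hlen : ∀ a s x, len (step a s x) ≤ len s + b (a, x)) :
    PT fun a => (l a).foldl (step a) (start a) := by
  obtain ⟨q, hq⟩ := hb
  set W : α → ℕ := fun a => q.eval (len a + len (l a) + 1) with hW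
  have hWb : PolyBdd W := ((PolyBdd.self.add hl.bdd).add (.const 1)).poly q
  refine PT.foldl_of_inv (b := fun a => len (start a) + len (l a) * W a) hl hs hstep
    -- Every element still to be processed carries a credit of `W a`, which pays for the growth
    -- caused by its step.
    (fun a m s => len s + m.length * W a ≤ len (start a) + (l a).length * W a)
    (fun a => le_rfl) (fun a s x m h hm => ?_) (hs.bdd.add (hl.bdd.mul hWb)) fun a m s h => ?_
  · have h2 := hlen a s x
    have h3 : b (a, x) ≤ W a := (hq _).trans (poly_mono q (by
      have := len_le_of_mem (hm.subset List.mem_cons_self); simp; omega))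
    rw [List.length_cons, Nat.add_one_mul] at h
    omega
  · have := Nat.mul_le_mul_right (W a) (length_le_len (l a))
    omega

@[fun_prop] theorem PT.reverse {l : α → List β} (hl : PT l) : PT fun a => (l a).reverse := by
  have : PT fun l : List β => l.foldl (fun s x => x :: s) [] :=
    PT.foldl (step := fun _ s x => x :: s) (b := fun x => len x) .id (.const _) (by fun_prop) .self
      fun a s x => by simp; omega
  simpa using this.comp hl

@[fun_prop] theorem PT.append {l m : α → List β} (hl : PT l) (hm : PT m) :
    PT fun a => l a ++ m a := by
  have := PT.foldl (l := fun a => (l a).reverse) (step := fun _ s x => x :: s)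
    (b := fun x => len x) (by fun_prop) hm (by fun_prop) .self fun a s x => by simp; omega
  simpa using this

theorem PT.map {l : α → List β} {f : α → β → γ} (hl : PT l)
    (hf : PT fun x : α × β => f x.1 x.2) : PT fun a => (l a).map (f a) := by
  have := PT.foldl (step := fun a s x => f a x :: s) (b := fun x => len (f x.1 x.2) + 1)
    hl (.const []) (.cons (hf.comp (g := fun x : α × β => f x.1 x.2)
      (f := fun x : α × List γ × β => (x.1, x.2.2)) (by fun_prop)) (by fun_prop))
    (hf.bdd.add (.const 1)) fun a s x => by simp; omega
  convert this.reverse using 2 with a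
  have : ∀ (m : List β) (s : List γ), m.foldl (fun s x => f a x :: s) s =
      (m.map (f a)).reverse ++ s := by
    intro m
    induction m with
    | nil => simp
    | cons x m ih => intro s; simp [ih]
  simp [this]

theorem PT.flatMap {l : α → List β} {f : α → β → List γ} (hl : PT l)
    (hf : PT fun x : α × β => f x.1 x.2) : PT fun a => (l a).flatMap (f a) := by
  have := PT.foldl (step := fun a s x => s ++ f a x) (b := fun x => len (f x.1 x.2))
    hl (.const []) (.append (by fun_prop) (hf.comp (g := fun x : α × β => f x.1 x.2)
      (f := fun x : α × List γ × β => (x.1, x.2.2)) (by fun_prop)))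
    hf.bdd fun a s x => by have := len_append s (f a x); dsimp only; omega
  convert this using 2 with a
  have : ∀ (m : List β) (s : List γ), m.foldl (fun s x => s ++ f a x) s =
      s ++ m.flatMap (f a) := by
    intro m
    induction m with
    | nil => simp
    | cons x m ih => intro s; simp [ih]
  simp [this]

theorem PT.sum_map {l : α → List β} {f : α → β → ℕ} (hl : PT l)
    (hf : PT fun x : α × β => f x.1 x.2) : PT fun a => ((l a).map (f a)).sum := by
  have := PT.foldl (step := fun a s x => s + f a x) (b := fun x => len (f x.1 x.2))
    hl (.const 0) (.add (by fun_prop) (hf.comp (g := fun x : α × β => f x.1 x.2)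
      (f := fun x : α × ℕ × β => (x.1, x.2.2)) (by fun_prop)))
    hf.bdd fun a s x => by
      have := @size_le_add s (f a x) (s + f a x) (by nlinarith)
      simp; omega
  convert this using 2 with a
  have : ∀ (m : List β) (s : ℕ), m.foldl (fun s x => s + f a x) s = s + (m.map (f a)).sum := by
    intro m
    induction m with
    | nil => simp
    | cons x m ih => intro s; simp [ih, add_assoc]
  simp [this]

theorem PT.length {l : α → List β} (hl : PT l) : PT fun a => (l a).length := by
  simpa using PT.sum_map (f := fun _ _ => 1) hl (.const 1)

/-- The growth per step depends on the running index, which belongs to the intermediate value, so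
`PT.foldl` does not apply. The invariant bounds the index by the length of the list. -/
theorem PT.zipIdx {l : α → List β} (hl : PT l) : PT fun a => (l a).zipIdx := by
  have hb : PolyBdd fun x : List β => len x * (len x + (len x + 1) + 1 + 1) + 1 :=
    (PolyBdd.self.mul (((PolyBdd.self.add (PolyBdd.self.add (.const 1))).add (.const 1)).add (.const 1))).add
      (.const 1)
  have : PT fun l : List β => l.foldl (fun s x => (s.1 + 1, (x, s.1) :: s.2))
      (0, ([] : List (β × ℕ))) := by
    refine PT.foldl_of_inv (step := fun _ s x => (s.1 + 1, (x, s.1) :: s.2))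
      (b := fun l => (len l + 1) + (len l * (len l + (len l + 1) + 1 + 1) + 1) + 1) .id (.const _)
      (by fun_prop)
      (fun l m s => s.1 + m.length = l.length ∧ s.2.length + m.length = l.length ∧
        ∀ x ∈ s.2, x.1 ∈ l ∧ x.2 ≤ l.length)
      (by simp) ?_ (((PolyBdd.self.add (.const 1)).add hb).add (.const 1)) ?_
    · rintro l ⟨i, s⟩ x m ⟨h1, h2, h3⟩ hm
      simp only [List.length_cons] at h1 h2 ⊢
      refine ⟨by omega, by omega, fun y hy => ?_⟩
      rcases List.mem_cons.1 hy with rfl | hy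
      · exact ⟨hm.subset List.mem_cons_self, by simp; omega⟩
      · exact h3 y hy
    · rintro l m ⟨i, s⟩ ⟨h1, h2, h3⟩
      have hl := length_le_len l
      have hsz : ∀ n, Nat.size n ≤ n := fun n => Nat.size_le.2 Nat.lt_two_pow_self
      have := hsz i
      have := len_list_le (l := s) (m := len l) (b := len l + (len l + 1) + 1) (by
        simp at h2; omega) fun x hx => by
          obtain ⟨y, j⟩ := x
          obtain ⟨h4, h5⟩ := h3 _ hx
          have h6 := len_le_of_mem h4
          have := hsz j
          simp only [len_pair, len_nat] at h5 h6 ⊢; omega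
      simp at h1 ⊢; omega
  have := (this.comp hl).snd.reverse
  convert this using 2 with a
  have : ∀ (m : List β) (i : ℕ) (s : List (β × ℕ)),
      (m.foldl (fun s x => (s.1 + 1, (x, s.1) :: s.2)) (i, s)).2 = (m.zipIdx i).reverse ++ s := by
    intro m
    induction m with
    | nil => simp
    | cons x m ih => intro i s; simp [ih]
  simp [this]

end

/-! ### Reading the components of an instance -/

theorem PT.tail {α β : Type} [Enc α] [Enc β] {l : α → List β} (hl : PT l) :
    PT fun a => (l a).tail := by
  have : PT fun l : List β => l.tail := .of_op .snd
    (fun l => by cases l <;> rfl) (PolyBdd.self.mono fun l => by cases l <;> simp; omega)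
  exact this.comp hl

theorem PT.of_cons {α β : Type} [Enc α] [Enc β] {l : α → List β} (hl : PT l) {f : α → β}
    (h : ∀ a, ∃ t, l a = f a :: t) : PT f := by
  obtain ⟨p, q, hp⟩ := hl
  refine .of_bdd (.seq p (.op .fst)) (((PolyBdd.self.add ⟨q, fun _ => le_rfl⟩).add
    ⟨q, fun _ => le_rfl⟩).add ⟨q, fun _ => le_rfl⟩) fun a => ?_
  obtain ⟨t, ht, hqt⟩ := hp a
  obtain ⟨m, hm⟩ := h a
  have := ht.size_le
  rw [hm] at ht this
  refine ⟨_, .seq ht (.op _ _), ?_⟩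
  have h1 : (enc (f a :: m)).size = len (f a) + len m + 1 := rfl
  have h2 : (Op.apply .fst (enc (f a :: m))).size = len (f a) := rfl
  have h3 : (enc a).size = len a := rfl
  omega

@[fun_prop] theorem PT.num {α : Type} [Enc α] {f : α → ℚ≥0} (hf : PT f) :
    PT fun a => (f a).num := by
  have : PT fun q : ℚ≥0 => q.num := .of_op .fst (fun _ => rfl) (PolyBdd.self.mono fun q => by
    change _ ≤ len (q.num, q.den); simp; omega)
  exact this.comp hf

@[fun_prop] theorem PT.den {α : Type} [Enc α] {f : α → ℚ≥0} (hf : PT f) :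
    PT fun a => (f a).den := by
  have : PT fun q : ℚ≥0 => q.den := .of_op .snd (fun _ => rfl) (PolyBdd.self.mono fun q => by
    change _ ≤ len (q.num, q.den); simp; omega)
  exact this.comp hf

@[fun_prop] theorem PT.demand {k : ℕ} : PT fun j : Job k => j.demand :=
  .of_op .fst (fun _ => rfl) (PolyBdd.self.mono fun j => by
    change _ ≤ len (j.demand, List.ofFn j.exec); simp; omega)

theorem PT.exec {k : ℕ} (i : Fin k) : PT fun j : Job k => j.exec i := by
  have h0 : PT fun j : Job k => List.ofFn j.exec :=
    .of_op .snd (fun _ => rfl) (PolyBdd.self.mono fun j => by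
      change _ ≤ len (j.demand, List.ofFn j.exec); simp; omega)
  have h1 : ∀ n, PT fun j : Job k => (List.ofFn j.exec).drop n := by
    intro n
    induction n with
    | zero => simpa using h0
    | succ n ih => simpa using ih.tail
  refine (h1 i).of_cons fun j => ⟨(List.ofFn j.exec).drop (i + 1), ?_⟩
  rw [List.drop_eq_getElem_cons (by simp)]
  simp

end ServerPlacement

namespace ServerPlacement

/-! ### Integral targets and gains -/

/-- A common denominator of the numbers that describe a job. -/
def Job.scale {k : ℕ} (j : Job k) : ℕ := j.demand.den * ∏ i, (j.exec i).den

/-- The demand of a job, multiplied by the common denominator. -/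
def Job.target {k : ℕ} (j : Job k) : ℕ := j.demand.num * j.scale / j.demand.den

/-- The execution table of a job, multiplied by the common denominator. -/
def Job.gain {k : ℕ} (j : Job k) (i : Fin k) : ℕ := (j.exec i).num * j.scale / (j.exec i).den

theorem cast_num_mul_div_den (q : ℚ≥0) {s : ℕ} (h : q.den ∣ s) :
    ((q.num * s / q.den : ℕ) : ℚ≥0) = q * s := by
  have hd : (q.den : ℚ≥0) ≠ 0 := by exact_mod_cast q.den_ne_zero
  rw [Nat.cast_div (h.mul_left _) hd]
  push_cast
  conv_rhs => rw [← NNRat.num_div_den q]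
  field_simp

theorem Job.scale_pos {k : ℕ} (j : Job k) : 0 < j.scale :=
  Nat.mul_pos j.demand.den_pos (Finset.prod_pos fun i _ => (j.exec i).den_pos)

theorem Job.target_eq {k : ℕ} (j : Job k) : (j.target : ℚ≥0) = j.demand * j.scale :=
  cast_num_mul_div_den _ (Dvd.intro _ rfl)

theorem Job.gain_eq {k : ℕ} (j : Job k) (i : Fin k) : (j.gain i : ℚ≥0) = j.exec i * j.scale :=
  cast_num_mul_div_den _ ((Finset.dvd_prod_of_mem _ (Finset.mem_univ i)).mul_left _)

theorem Job.gain_mono {k : ℕ} (j : Job k) : Monotone j.gain := fun a b h => by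
  have : (j.gain a : ℚ≥0) ≤ j.gain b := by
    rw [j.gain_eq, j.gain_eq]
    gcongr
    exact j.exec_mono h
  exact_mod_cast this

/-! ### The dynamic program -/

/-- A machine under construction: the number of unused processors, and the blocks that have been
formed, each described by the number of its job and its size. -/
abbrev Bin : Type := ℕ × List (ℕ × ℕ)

/-- A partial placement. The first component is the key, which determines how many machines have
any given number of unused processors, the second one is the amount by which the demand of the
current job is satisfied. -/
abbrev State : Type := ℕ × ℕ × List Bin

/-- Put a block on some machine with `r` unused processors, of which `r'` are left. The first
component of the result is zero if there is no such machine. -/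
def putBlock (r r' : ℕ) (b : ℕ × ℕ) (ms : List Bin) : ℕ × List Bin :=
  ms.foldl (fun s m => if s.1 = 0 then if m.1 = r then (1, (r', b :: m.2) :: s.2)
    else (0, m :: s.2) else (1, m :: s.2)) (0, [])

/-- Extend a partial placement by a block of size `i + 1` for the job `c.2`, on a machine of
which `e` processors remain unused. -/
def extend {k : ℕ} (i : Fin k) (e : ℕ) (c : (ℕ × ℕ) × Job k × ℕ) (s : State) : List State :=
  if (putBlock (e + (i + 1)) e (c.2.2, i + 1) s.2.2).1 ≠ 0 then
    [(s.1 + c.1.1 ^ e - c.1.1 ^ (e + (i + 1)), s.2.1 + c.1.2 * c.2.1.gain i,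
      (putBlock (e + (i + 1)) e (c.2.2, i + 1) s.2.2).2)]
  else []

/-- All extensions of a partial placement by one block for the job `c.2`. -/
def extensions {k : ℕ} (c : (ℕ × ℕ) × Job k × ℕ) (s : State) : List State :=
  (List.finRange k ×ˢ List.range k).flatMap fun x => extend x.1 x.2 c s

/-- Add a partial placement to a table that keeps the best one for every key. -/
def insertBest (s : State) (T : List State) : List State :=
  let r := T.foldl (fun x t => if t.1 = x.1.1 then if x.1.2.1 ≤ t.2.1 then (t, x.2) else x
    else (x.1, t :: x.2)) (s, [])
  r.1 :: r.2

/-- Keep a best partial placement for every key. -/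
def prune (T : List State) : List State := T.foldl (fun T s => insertBest s T) []

/-- Add all extensions by one block for the job `c.2` to a table of partial placements. -/
def expand {k : ℕ} (c : (ℕ × ℕ) × Job k × ℕ) (T : List State) : List State :=
  prune (T ++ T.flatMap (extensions c))

/-- Keep the partial placements that satisfy the demand of a job. -/
def finish {k : ℕ} (j : Job k) (T : List State) : List State :=
  T.flatMap fun s => if j.target ≤ s.2.1 then [(s.1, 0, s.2.2)] else []

/-- The two kinds of steps of the dynamic program. -/
def tableStep {k : ℕ} (c : ℕ × ℕ) (T : List State) (x : ℕ × Job k × ℕ) : List State :=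
  if x.1 = 0 then expand (c, x.2) T else finish x.2.1 T

/-- `c` copies of a list. -/
def copies {α : Type} (c : ℕ) (l : List α) : List α := (List.range c).flatMap fun _ => l

/-- The steps of the dynamic program. -/
def steps {k : ℕ} (c : ℕ) (I : Packing k) : List (ℕ × Job k × ℕ) :=
  I.zipIdx.flatMap fun x => (copies (k * c) I).map (fun _ => (0, x)) ++ [(1, x)]

/-- The table of partial placements on `c * I.length` machines that satisfy all demands up to a
factor of `u`. -/
def table {k : ℕ} (c u : ℕ) (I : Packing k) : List State :=
  (steps c I).foldl (tableStep (c * I.length + 1, u))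
    [(c * I.length * (c * I.length + 1) ^ k, 0, (copies c I).map fun _ => (k, []))]

/-- The entry of a table with the largest key. -/
def best (T : List State) : State := T.foldl (fun s t => if s.1 ≤ t.1 then t else s) (0, 0, [])

/-- The number of machines needed when every block consists of all processors. -/
def coarse {k : ℕ} (I : Packing (k + 1)) : ℕ :=
  (I.map fun j => (j.target + j.gain (Fin.last k) - 1) / j.gain (Fin.last k)).sum

/-- The number of equal machines that are placed together. -/
def bundle {k : ℕ} (E : ℕ) (I : Packing (k + 1)) : ℕ :=
  if coarse I / (E * I.length) = 0 then 1 else coarse I / (E * I.length)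

/-- The approximation scheme. -/
def scheme {k : ℕ} (E c : ℕ) (I : Packing (k + 1)) : List (ℕ × List (ℕ × ℕ)) :=
  (best (table c (bundle E I) I)).2.2.map fun m => (bundle E I, m.2)

theorem length_copies {α : Type} (c : ℕ) (l : List α) : (copies c l).length = c * l.length := by
  simp [copies]

/-! ### Properties of the elementary steps -/

/-- The fold permutes the machines, which is harmless: all later statements depend on them only up
to permutation. -/
theorem putBlock_eq_zero_or (r r' : ℕ) (b : ℕ × ℕ) (ms : List Bin) :
    ((putBlock r r' b ms).1 = 0 ∧ r ∉ ms.map Prod.fst) ∨ ((putBlock r r' b ms).1 ≠ 0 ∧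
      ∃ m rest, ms.Perm ((r, m) :: rest) ∧ (putBlock r r' b ms).2.Perm ((r', b :: m) :: rest)) := by
  set f : ℕ × List Bin → Bin → ℕ × List Bin := fun s m =>
    if s.1 = 0 then if m.1 = r then (1, (r', b :: m.2) :: s.2)
      else (0, m :: s.2) else (1, m :: s.2) with hf
  have h1 : ∀ (ms acc : List Bin), ms.foldl f (1, acc) = (1, ms.reverse ++ acc) := by
    intro ms
    induction ms with
    | nil => simp
    | cons m ms ih => intro acc; simp [hf] at ih ⊢; simp [ih]
  have h2 : ∀ (ms acc : List Bin), ((ms.foldl f (0, acc)).1 = 0 ∧ r ∉ ms.map Prod.fst) ∨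
      ((ms.foldl f (0, acc)).1 ≠ 0 ∧ ∃ m rest, (ms ++ acc).Perm ((r, m) :: rest) ∧
        (ms.foldl f (0, acc)).2.Perm ((r', b :: m) :: rest)) := by
    intro ms
    induction ms with
    | nil => simp
    | cons m ms ih =>
      intro acc
      obtain ⟨a, m⟩ := m
      by_cases h : a = r
      · right
        have h3 : f (0, acc) (a, m) = (1, (r', b :: m) :: acc) := by simp [hf, h]
        rw [List.foldl_cons, h3, h1]
        refine ⟨by simp, m, ms ++ acc, by simp [h], ?_⟩
        exact List.perm_middle.trans (List.Perm.cons _ ((List.reverse_perm ms).append_right acc))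
      · have h3 : f (0, acc) (a, m) = (0, (a, m) :: acc) := by simp [hf, h]
        rw [List.foldl_cons, h3]
        rcases ih ((a, m) :: acc) with ⟨h4, h5⟩ | ⟨h4, m', rest, h5, h6⟩
        · exact .inl ⟨h4, by simpa [Ne.symm h] using h5⟩
        · exact .inr ⟨h4, m', rest, (List.perm_middle.symm.trans h5), h6⟩
  have h3 := h2 ms []
  rw [List.append_nil] at h3
  exact h3

/-- Every entry of `T` has a counterpart in `T'` that is at least as good. -/
def Covers (T' T : List State) : Prop := ∀ t ∈ T, ∃ t' ∈ T', t'.1 = t.1 ∧ t.2.1 ≤ t'.2.1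

theorem Covers.trans {T T' T'' : List State} (h : Covers T'' T') (h' : Covers T' T) :
    Covers T'' T := fun t ht => by
  obtain ⟨t', ht', h1, h2⟩ := h' t ht
  obtain ⟨t'', ht'', h3, h4⟩ := h t' ht'
  exact ⟨t'', ht'', h3.trans h1, h2.trans h4⟩

theorem insertBest_spec (s : State) (T : List State) :
    (∀ t ∈ insertBest s T, t ∈ s :: T) ∧ Covers (insertBest s T) (s :: T) ∧
      ((T.map Prod.fst).Nodup → ((insertBest s T).map Prod.fst).Nodup) := by
  set f : State × List State → State → State × List State := fun x t =>
    if t.1 = x.1.1 then if x.1.2.1 ≤ t.2.1 then (t, x.2) else x else (x.1, t :: x.2) with hf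
  -- `x.1` is the best entry so far with the key of `s`; `x.2` collects the entries with other keys.
  have key : ∀ (T : List State) (x : State × List State),
      (∀ t ∈ (T.foldl f x).1 :: (T.foldl f x).2, t ∈ x.1 :: (x.2 ++ T)) ∧
      Covers ((T.foldl f x).1 :: (T.foldl f x).2) (x.1 :: (x.2 ++ T)) ∧
      (((x.2 ++ T).map Prod.fst).Nodup → x.1.1 ∉ x.2.map Prod.fst →
        (((T.foldl f x).1 :: (T.foldl f x).2).map Prod.fst).Nodup) := by
    intro T
    induction T with
    | nil =>
      intro x
      refine ⟨by simp, fun t ht => ⟨t, by simpa using ht, rfl, le_rfl⟩, fun h1 h2 => ?_⟩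
      simp at h1 h2 ⊢
      exact ⟨h2, h1⟩
    | cons t T ih =>
      rintro ⟨cur, acc⟩
      rw [List.foldl_cons]
      obtain ⟨h1, h2, h3⟩ := ih (f (cur, acc) t)
      by_cases hk : t.1 = cur.1
      · by_cases hv : cur.2.1 ≤ t.2.1
        · have hft : f (cur, acc) t = (t, acc) := by simp [hf, hk, hv]
          rw [hft] at h1 h2 h3 ⊢
          refine ⟨fun y hy => ?_, h2.trans fun y hy => ?_, fun h4 h5 => h3 ?_ ?_⟩
          · have := h1 y hy; simp at this ⊢; tauto
          · simp at hy
            rcases hy with rfl | hy | rfl | hy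
            · exact ⟨t, by simp, hk, hv⟩
            · exact ⟨y, by simp [hy], rfl, le_rfl⟩
            · exact ⟨y, by simp, rfl, le_rfl⟩
            · exact ⟨y, by simp [hy], rfl, le_rfl⟩
          · exact h4.sublist (((List.Sublist.refl acc).append (List.sublist_cons_self t T)).map _)
          · simpa [hk] using h5
        · have hft : f (cur, acc) t = (cur, acc) := by simp [hf, hk, hv]
          rw [hft] at h1 h2 h3 ⊢
          refine ⟨fun y hy => ?_, h2.trans fun y hy => ?_, fun h4 h5 => h3 ?_ h5⟩
          · have := h1 y hy; simp at this ⊢; tauto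
          · simp at hy
            rcases hy with rfl | hy | rfl | hy
            · exact ⟨y, by simp, rfl, le_rfl⟩
            · exact ⟨y, by simp [hy], rfl, le_rfl⟩
            · exact ⟨cur, by simp, hk.symm, by omega⟩
            · exact ⟨y, by simp [hy], rfl, le_rfl⟩
          · exact h4.sublist (((List.Sublist.refl acc).append (List.sublist_cons_self t T)).map _)
      · have hft : f (cur, acc) t = (cur, t :: acc) := by simp [hf, hk]
        rw [hft] at h1 h2 h3 ⊢
        refine ⟨fun y hy => ?_, h2.trans fun y hy => ?_, fun h4 h5 => h3 ?_ ?_⟩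
        · have := h1 y hy; simp at this ⊢; tauto
        · exact ⟨y, by simp at hy ⊢; tauto, rfl, le_rfl⟩
        · exact ((List.perm_middle (l₁ := acc)).map Prod.fst).nodup_iff.1 h4
        · simp at h5 ⊢
          exact ⟨fun h => hk h.symm, h5⟩
  obtain ⟨h1, h2, h3⟩ := key T (s, [])
  exact ⟨h1, h2, fun h => h3 h (by simp)⟩

theorem prune_spec (T : List State) :
    (∀ t ∈ prune T, t ∈ T) ∧ Covers (prune T) T ∧ ((prune T).map Prod.fst).Nodup := by
  have key : ∀ T S : List State, (S.map Prod.fst).Nodup →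
      (∀ t ∈ T.foldl (fun T s => insertBest s T) S, t ∈ S ++ T) ∧
      Covers (T.foldl (fun T s => insertBest s T) S) (S ++ T) ∧
      ((T.foldl (fun T s => insertBest s T) S).map Prod.fst).Nodup := by
    intro T
    induction T with
    | nil => exact fun S h => ⟨by simp, fun t ht => ⟨t, by simpa using ht, rfl, le_rfl⟩, by simpa⟩
    | cons t T ih =>
      intro S hS
      obtain ⟨h1, h2, h3⟩ := insertBest_spec t S
      obtain ⟨h4, h5, h6⟩ := ih (insertBest t S) (h3 hS)
      refine ⟨fun y hy => ?_, h5.trans fun y hy => ?_, h6⟩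
      · have h7 := h4 y hy
        have h8 := h1 y
        simp at h7 h8 ⊢; tauto
      · have h7 : y ∈ t :: S ∨ y ∈ T := by simp at hy ⊢; tauto
        rcases h7 with h7 | h7
        · obtain ⟨z, hz, h8⟩ := h2 y h7
          exact ⟨z, List.mem_append_left _ hz, h8⟩
        · exact ⟨y, List.mem_append_right _ h7, rfl, le_rfl⟩
  simpa [prune] using key T [] (by simp)

theorem best_spec {T : List State} (h : T ≠ []) : best T ∈ T ∧ ∀ t ∈ T, t.1 ≤ (best T).1 := by
  have key : ∀ (T : List State) (s : State),
      T.foldl (fun s t => if s.1 ≤ t.1 then t else s) s ∈ s :: T ∧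
      ∀ t ∈ s :: T, t.1 ≤ (T.foldl (fun s t => if s.1 ≤ t.1 then t else s) s).1 := by
    intro T
    induction T with
    | nil => simp
    | cons t T ih =>
      intro s
      rw [List.foldl_cons]
      split_ifs with h
      · obtain ⟨h1, h2⟩ := ih t
        exact ⟨List.mem_cons_of_mem _ h1, fun x hx => (List.mem_cons.1 hx).elim
          (fun e => e ▸ h.trans (h2 t (by simp))) (h2 x)⟩
      · obtain ⟨h1, h2⟩ := ih s
        refine ⟨by simp at h1 ⊢; tauto, fun x hx => ?_⟩
        rcases List.mem_cons.1 hx with rfl | hx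
        · exact h2 _ (by simp)
        rcases List.mem_cons.1 hx with rfl | hx
        · have := h2 s (by simp); omega
        · exact h2 _ (by simp [hx])
  obtain ⟨t, T, rfl⟩ := List.exists_cons_of_ne_nil h
  -- The dummy start has key `0`, so the first entry replaces it.
  have : best (t :: T) = T.foldl (fun s t => if s.1 ≤ t.1 then t else s) t := by
    simp [best]
  rw [this]
  exact key T t

end ServerPlacement

namespace ServerPlacement

/-! ### Invariants of the table -/

/-- The invariant of the partial placements in the table: there are `M` machines with `k` processors
each, whose blocks belong to jobs with numbers below `n`. -/
structure Good (k M n W : ℕ) (s : State) : Prop where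
  length_eq : s.2.2.length = M
  sum_eq : ∀ m ∈ s.2.2, (m.2.map Prod.snd).sum + m.1 = k
  block : ∀ m ∈ s.2.2, ∀ b ∈ m.2, b.1 < n ∧ 1 ≤ b.2 ∧ b.2 ≤ k
  key_eq : s.1 = (s.2.2.map fun m => (M + 1) ^ m.1).sum
  val_le : s.2.1 + W * (s.2.2.map Prod.fst).sum ≤ W * (k * M)

theorem extend_spec {k : ℕ} {i : Fin k} {e : ℕ} {c : (ℕ × ℕ) × Job k × ℕ} {s t : State}
    (h : t ∈ extend i e c s) :
    t.1 = s.1 + c.1.1 ^ e - c.1.1 ^ (e + (i + 1)) ∧ t.2.1 = s.2.1 + c.1.2 * c.2.1.gain i ∧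
      ∃ m rest, s.2.2.Perm ((e + (i + 1), m) :: rest) ∧
        t.2.2.Perm ((e, (c.2.2, i + 1) :: m) :: rest) := by
  rw [extend] at h
  split_ifs at h with h1
  · obtain rfl := List.mem_singleton.1 h
    refine ⟨rfl, rfl, ?_⟩
    rcases putBlock_eq_zero_or (e + (i + 1)) e (c.2.2, i + 1) s.2.2 with h2 | h2
    · exact absurd h2.1 h1
    · exact h2.2
  · simp at h

theorem Good.extend {k M n W : ℕ} {i : Fin k} {e : ℕ} {c : (ℕ × ℕ) × Job k × ℕ} {s t : State}
    (hs : Good k M n W s) (hB : c.1.1 = M + 1) (hn : c.2.2 < n)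
    (hW : c.1.2 * c.2.1.gain i ≤ W) (h : t ∈ ServerPlacement.extend i e c s) : Good k M n W t := by
  obtain ⟨h1, h2, m, rest, h3, h4⟩ := extend_spec h
  have hrest : ∀ x ∈ rest, x ∈ s.2.2 := fun x hx => h3.mem_iff.2 (List.mem_cons_of_mem _ hx)
  have hm : (e + (↑i + 1), m) ∈ s.2.2 := h3.mem_iff.2 List.mem_cons_self
  refine ⟨?_, fun x hx => ?_, fun x hx b hb => ?_, ?_, ?_⟩
  · rw [h4.length_eq, ← hs.length_eq, h3.length_eq]; rfl
  · rcases List.mem_cons.1 (h4.mem_iff.1 hx) with rfl | hx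
    · have := hs.sum_eq _ hm
      simp at this ⊢; omega
    · exact hs.sum_eq x (hrest x hx)
  · rcases List.mem_cons.1 (h4.mem_iff.1 hx) with rfl | hx
    · rcases List.mem_cons.1 hb with rfl | hb
      · exact ⟨hn, by simp, i.2⟩
      · exact hs.block _ hm b hb
    · exact hs.block x (hrest x hx) b hb
  -- The subtraction in the new key is not truncated, since the chosen machine contributes the
  -- subtracted power to the old key.
  · have h5 := hs.key_eq
    rw [(h3.map _).sum_eq] at h5
    rw [(h4.map _).sum_eq, h1, h5, hB]
    simp only [List.map_cons, List.sum_cons]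
    omega
  -- A block adds at most `W` to the value and takes up at least one processor, so the potential
  -- does not increase.
  · have h5 := hs.val_le
    rw [(h3.map _).sum_eq] at h5
    rw [(h4.map _).sum_eq, h2]
    simp only [List.map_cons, List.sum_cons, mul_add] at h5 ⊢
    omega

theorem mem_extensions {k : ℕ} {c : (ℕ × ℕ) × Job k × ℕ} {s t : State} :
    t ∈ extensions c s ↔ ∃ i : Fin k, ∃ e < k, t ∈ extend i e c s := by
  simp [extensions, List.mem_flatMap]

theorem mem_expand {k : ℕ} {c : (ℕ × ℕ) × Job k × ℕ} {T : List State} {t : State}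
    (h : t ∈ expand c T) : t ∈ T ∨ ∃ s ∈ T, t ∈ extensions c s := by
  simpa using (prune_spec _).1 t h

theorem mem_finish {k : ℕ} {j : Job k} {T : List State} {t : State} :
    t ∈ finish j T ↔ ∃ s ∈ T, j.target ≤ s.2.1 ∧ t = (s.1, 0, s.2.2) := by
  simp [finish]

/-- The total gain of one block of each size for each job. -/
def totalGain {k : ℕ} (I : Packing k) : ℕ := (I.map fun j => ∑ i, j.gain i).sum

theorem gain_le_totalGain {k : ℕ} {I : Packing k} {j : Job k} (hj : j ∈ I) (i : Fin k) :
    j.gain i ≤ totalGain I :=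
  (Finset.single_le_sum (f := j.gain) (fun _ _ => Nat.zero_le _) (Finset.mem_univ i)).trans
    (List.single_le_sum (by simp) _ (List.mem_map_of_mem hj))

/-- The invariant of the table. -/
def GoodTable {k : ℕ} (c u : ℕ) (I : Packing k) (T : List State) : Prop :=
  (T.map Prod.fst).Nodup ∧ ∀ s ∈ T, Good k (c * I.length) I.length (u * totalGain I) s

theorem GoodTable.expand {k c u : ℕ} {I : Packing k} {T : List State} (h : GoodTable c u I T)
    {x : Job k × ℕ} (hx : x ∈ I.zipIdx) :
    GoodTable c u I (expand ((c * I.length + 1, u), x) T) := by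
  refine ⟨(prune_spec _).2.2, fun t ht => ?_⟩
  rcases mem_expand ht with ht | ⟨s, hs, ht⟩
  · exact h.2 t ht
  · obtain ⟨i, e, -, ht⟩ := mem_extensions.1 ht
    have h1 := List.fst_mem_of_mem_zipIdx hx
    have h2 := List.snd_lt_of_mem_zipIdx hx
    exact (h.2 s hs).extend rfl (by simpa using h2)
      (Nat.mul_le_mul_left _ (gain_le_totalGain h1 i)) ht

theorem GoodTable.finish {k c u : ℕ} {I : Packing k} {T : List State} (h : GoodTable c u I T)
    (j : Job k) : GoodTable c u I (finish j T) := by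
  refine ⟨h.1.sublist ?_, fun t ht => ?_⟩
  · have : ∀ T : List State, ((ServerPlacement.finish j T).map Prod.fst).Sublist (T.map Prod.fst) := by
      intro T
      induction T with
      | nil => simp [ServerPlacement.finish]
      | cons s T ih =>
        simp only [ServerPlacement.finish, List.flatMap_cons, List.map_append, List.map_cons] at ih ⊢
        split_ifs
        · exact ih.cons_cons _
        · exact ih.cons _
    exact this T
  · obtain ⟨s, hs, -, rfl⟩ := mem_finish.1 ht
    have := h.2 s hs
    exact ⟨this.length_eq, this.sum_eq, this.block, this.key_eq,
      le_trans (by simp) this.val_le⟩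

theorem mem_steps {k c : ℕ} {I : Packing k} {x : ℕ × Job k × ℕ} (h : x ∈ steps c I) :
    x.2 ∈ I.zipIdx := by
  simp only [steps, List.mem_flatMap, List.mem_append, List.mem_map, List.mem_singleton] at h
  obtain ⟨a, ha, ⟨_, _, rfl⟩ | rfl⟩ := h <;> exact ha

theorem GoodTable.tableStep {k c u : ℕ} {I : Packing k} {T : List State} (h : GoodTable c u I T)
    {x : ℕ × Job k × ℕ} (hx : x.2 ∈ I.zipIdx) :
    GoodTable c u I (tableStep (c * I.length + 1, u) T x) := by
  rw [ServerPlacement.tableStep]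
  split_ifs
  · exact h.expand hx
  · exact h.finish _

theorem goodTable_start {k : ℕ} (c u : ℕ) (I : Packing k) : GoodTable c u I
    [(c * I.length * (c * I.length + 1) ^ k, 0, (copies c I).map fun _ => (k, []))] := by
  refine ⟨by simp, fun s hs => ?_⟩
  obtain rfl := List.mem_singleton.1 hs
  refine ⟨by simp [length_copies], by simp, by simp, ?_, ?_⟩
  · simp [length_copies]
  · simp [length_copies, mul_comm k]

theorem GoodTable.foldl {k c u : ℕ} {I : Packing k} (l : List (ℕ × Job k × ℕ))
    (hl : ∀ x ∈ l, x.2 ∈ I.zipIdx) {T : List State} (h : GoodTable c u I T) :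
    GoodTable c u I (l.foldl (ServerPlacement.tableStep (c * I.length + 1, u)) T) := by
  induction l generalizing T with
  | nil => exact h
  | cons x l ih =>
    exact ih (fun y hy => hl y (List.mem_cons_of_mem _ hy)) (h.tableStep (hl x (by simp)))

theorem goodTable_table {k : ℕ} (c u : ℕ) (I : Packing k) : GoodTable c u I (table c u I) :=
  (goodTable_start c u I).foldl _ fun _ => mem_steps

/-! ### Running time of the scheme -/

theorem size_le_self (n : ℕ) : Nat.size n ≤ n := Nat.size_le.2 Nat.lt_two_pow_self

theorem Good.key_lt {k M n W : ℕ} {s : State} (h : Good k M n W s) : s.1 < (M + 1) ^ (k + 1) := by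
  have h1 : s.1 ≤ M * (M + 1) ^ k := by
    rw [h.key_eq]
    have := List.sum_le_card_nsmul (s.2.2.map fun m => (M + 1) ^ m.1) ((M + 1) ^ k) (by
      intro x hx
      obtain ⟨m, hm, rfl⟩ := List.mem_map.1 hx
      have := h.sum_eq m hm
      exact Nat.pow_le_pow_right (by omega) (by omega))
    simpa [h.length_eq] using this
  have : 0 < (M + 1) ^ k := by positivity
  rw [pow_succ]
  nlinarith

/-- Keys, remainders, job numbers and block sizes are small enough to bound their binary length by
their value. Only the accumulated amount may be exponentially large, so it enters through the length
of its bound `W * (k * M)`. -/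
theorem Good.len_le {k M n W : ℕ} {s : State} (h : Good k M n W s) :
    len s ≤ ((M + 1) ^ (k + 1) + 1) + (len (W * (k * M)) + (M * ((k + 1) +
      (k * (((n + 1) + (k + 1) + 1) + 1) + 1) + 1 + 1) + 1) + 1) + 1 := by
  obtain ⟨key, val, ms⟩ := s
  have h1 := h.key_lt
  have h2 := size_le_self key
  have h3 : Nat.size val ≤ Nat.size (W * (k * M)) :=
    Nat.size_le_size ((Nat.le_add_right _ _).trans h.val_le)
  have h4 : len ms ≤ M * ((k + 1) + (k * (((n + 1) + (k + 1) + 1) + 1) + 1) + 1 + 1) + 1 := by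
    refine len_list_le h.length_eq.le fun m hm => ?_
    obtain ⟨r, bs⟩ := m
    have h5 := h.sum_eq _ hm
    have h6 := h.block _ hm
    dsimp only at h5 h6
    have h7 : bs.length ≤ k := by
      have := List.card_nsmul_le_sum (bs.map Prod.snd) 1 (by
        intro x hx
        obtain ⟨b, hb, rfl⟩ := List.mem_map.1 hx
        exact (h6 b hb).2.1)
      simp at this; omega
    have h8 := len_list_le (b := (n + 1) + (k + 1) + 1) h7 fun b hb => by
      obtain ⟨i, p⟩ := b
      have h9 := h6 _ hb
      have := size_le_self i
      have := size_le_self p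
      simp at h9 ⊢; omega
    have := size_le_self r
    rw [len_pair, len_nat]; omega
  simp only [len_pair, len_nat] at h1 h2 h3 ⊢
  omega

/-- Distinct keys below `(M + 1) ^ (k + 1)`: this is where `k` being constant makes the dynamic
program polynomial. -/
theorem GoodTable.length_le {k c u : ℕ} {I : Packing k} {T : List State} (h : GoodTable c u I T) :
    T.length ≤ (c * I.length + 1) ^ (k + 1) := by
  have h1 := List.toFinset_card_of_nodup h.1
  have h2 : (T.map Prod.fst).toFinset ⊆ Finset.range ((c * I.length + 1) ^ (k + 1)) := by
    intro x hx
    obtain ⟨s, hs, rfl⟩ := List.mem_map.1 (List.mem_toFinset.1 hx)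
    exact Finset.mem_range.2 (h.2 s hs).key_lt
  have := Finset.card_le_card h2
  simpa [h1] using this

section
variable {α β : Type} [Enc α] [Enc β]

/-- The list `l` does not depend on the input, so the iteration is unrolled into the program. -/
theorem PT.flatMap_const {ι : Type} (l : List ι) {f : ι → α → List β} (hf : ∀ i, PT (f i)) :
    PT fun a => l.flatMap fun i => f i a := by
  induction l with
  | nil => simpa using PT.const []
  | cons i l ih => simpa only [List.flatMap_cons] using (hf i).append ih

theorem PT.copies {l : α → List β} (hl : PT l) (c : ℕ) : PT fun a => copies c (l a) :=
  PT.flatMap_const _ fun _ => hl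

end

theorem PT.scale {k : ℕ} : PT fun j : Job k => j.scale :=
  .mul (by fun_prop) (PT.prod _ fun i => (PT.exec i).den)

@[fun_prop] theorem PT.target {k : ℕ} : PT fun j : Job k => j.target :=
  .div (.mul (by fun_prop) .scale) (by fun_prop)

@[fun_prop] theorem PT.gain {k : ℕ} (i : Fin k) : PT fun j : Job k => j.gain i :=
  .div (.mul (PT.exec i).num .scale) (PT.exec i).den

theorem PT.putBlock (r r' : ℕ) : PT fun x : (ℕ × ℕ) × List Bin => putBlock r r' x.1 x.2 := by
  refine PT.foldl (step := fun (x : (ℕ × ℕ) × List Bin) s m =>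
    if s.1 = 0 then if m.1 = r then (1, (r', x.1 :: m.2) :: s.2)
    else (0, m :: s.2) else (1, m :: s.2)) (b := fun x => len x.1.1 + len x.2 + Nat.size r' + 10)
    (by fun_prop) (.const _) ?_ ?_ ?_
  · refine .ite_eq (by fun_prop) (by fun_prop) (.ite_eq (by fun_prop) (by fun_prop) ?_ ?_) ?_ <;>
      fun_prop
  · refine .add (.add (.add ?_ ?_) (.const _)) (.const _)
    · exact PT.bdd (f := fun x : ((ℕ × ℕ) × List Bin) × Bin => x.1.1) (by fun_prop)
    · exact PT.bdd (f := fun x : ((ℕ × ℕ) × List Bin) × Bin => x.2) (by fun_prop)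
  · rintro ⟨b, l⟩ ⟨a, acc⟩ ⟨r, m⟩
    have : Nat.size 1 = 1 := rfl
    have : Nat.size 0 = 0 := rfl
    dsimp only
    split_ifs <;> simp only [len_pair, len_cons, len_nat] <;> omega

theorem PT.extend {k : ℕ} (i : Fin k) (e : ℕ) :
    PT fun x : ((ℕ × ℕ) × Job k × ℕ) × State => extend i e x.1 x.2 := by
  have h : PT fun x : ((ℕ × ℕ) × Job k × ℕ) × State =>
      ServerPlacement.putBlock (e + (i + 1)) e (x.1.2.2, i + 1) x.2.2.2 :=
    (PT.putBlock (e + (i + 1)) e).comp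
      (f := fun x : ((ℕ × ℕ) × Job k × ℕ) × State => ((x.1.2.2, (i : ℕ) + 1), x.2.2.2))
      (by fun_prop)
  refine PT.ite_ne_zero h.fst (.cons (.prodMk ?_ (.prodMk ?_ h.snd)) (.const _)) (.const _) <;>
    fun_prop

theorem PT.insertBest : PT fun x : State × List State => insertBest x.1 x.2 := by
  have : PT fun x : State × List State => x.2.foldl (fun (y : State × List State) t =>
      if t.1 = y.1.1 then if y.1.2.1 ≤ t.2.1 then (t, y.2) else y else (y.1, t :: y.2))
      (x.1, []) := by
    refine PT.foldl (step := fun (x : State × List State) (y : State × List State) t =>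
      if t.1 = y.1.1 then if y.1.2.1 ≤ t.2.1 then (t, y.2) else y else (y.1, t :: y.2))
      (b := fun x => len x.2 + 1) (by fun_prop) (by fun_prop) ?_ ?_ ?_
    · refine .ite_eq (by fun_prop) (by fun_prop) (.ite_le (by fun_prop) (by fun_prop) ?_ ?_) ?_ <;>
        fun_prop
    · exact .add (PT.bdd (f := fun x : (State × List State) × State => x.2) (by fun_prop))
        (.const _)
    · rintro x ⟨s, acc⟩ t
      dsimp only
      split_ifs <;> simp only [len_pair (α := State), len_cons] <;> omega
  exact .cons this.fst this.snd

theorem len_insertBest (s : State) (T : List State) :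
    len (insertBest s T) ≤ len T + (len s + 2) := by
  have : ∀ (T : List State) (y : State × List State),
      len (T.foldl (fun (y : State × List State) t =>
        if t.1 = y.1.1 then if y.1.2.1 ≤ t.2.1 then (t, y.2) else y else (y.1, t :: y.2)) y) ≤
      len y + len T := by
    intro T
    induction T with
    | nil => simp
    | cons t T ih =>
      rintro ⟨s, acc⟩
      refine (ih _).trans ?_
      dsimp only
      split_ifs <;> simp only [len_pair (α := State), len_cons] <;> omega
  have h := this T (s, [])
  have h1 : len (s, ([] : List State)) = len s + 1 + 1 := rfl
  have h2 : ∀ y : State × List State, len (y.1 :: y.2) = len y := fun _ => rfl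
  rw [insertBest, h2]
  omega

theorem PT.prune : PT prune := by
  refine PT.foldl (step := fun _ T s => ServerPlacement.insertBest s T)
    (b := fun x => len x.2 + 2) .id (.const _)
    (PT.insertBest.comp (f := fun x : List State × List State × State => (x.2.2, x.2.1))
      (by fun_prop)) ?_ fun a s x => len_insertBest _ _
  exact .add (PT.bdd (f := fun x : List State × State => x.2) (by fun_prop)) (.const _)

theorem PT.expand {k : ℕ} :
    PT fun x : ((ℕ × ℕ) × Job k × ℕ) × List State => expand x.1 x.2 :=
  PT.prune.comp (.append (by fun_prop) (.flatMap (f := fun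
    (x : ((ℕ × ℕ) × Job k × ℕ) × List State) s => extensions x.1 s) (by fun_prop)
    (PT.flatMap_const _ fun y => (PT.extend y.1 y.2).comp
      (f := fun x : (((ℕ × ℕ) × Job k × ℕ) × List State) × State => (x.1.1, x.2)) (by fun_prop))))

theorem PT.finish {k : ℕ} : PT fun x : Job k × List State => finish x.1 x.2 := by
  refine PT.flatMap (f := fun (x : Job k × List State) (s : State) =>
    if x.1.target ≤ s.2.1 then [(s.1, 0, s.2.2)] else []) (by fun_prop) ?_
  refine .ite_le ?_ ?_ ?_ ?_ <;> fun_prop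

theorem PT.tableStep {k : ℕ} :
    PT fun x : (ℕ × ℕ) × List State × (ℕ × Job k × ℕ) => tableStep x.1 x.2.1 x.2.2 := by
  refine .ite_eq (by fun_prop) (by fun_prop) ?_ ?_
  · exact PT.expand.comp (f := fun x : (ℕ × ℕ) × List State × (ℕ × Job k × ℕ) =>
      ((x.1, x.2.2.2), x.2.1)) (by fun_prop)
  · exact PT.finish.comp (f := fun x : (ℕ × ℕ) × List State × (ℕ × Job k × ℕ) =>
      (x.2.2.2.1, x.2.1)) (by fun_prop)

/-- Constantly many copies of the instance serve as a unary counter for the rounds, so no conversion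
from binary to unary is needed. -/
theorem PT.steps {k : ℕ} (c : ℕ) : PT fun I : Packing k => steps c I :=
  PT.flatMap (f := fun (I : Packing k) x => (ServerPlacement.copies (k * c) I).map
    (fun _ => (0, x)) ++ [(1, x)]) (.zipIdx .id) (.append (.map (f := fun
      (x : Packing k × Job k × ℕ) (_ : Job k) => (0, x.2)) (.copies .fst_aux _) (by fun_prop))
      (by fun_prop))

theorem PT.totalGain {k : ℕ} : PT fun I : Packing k => totalGain I :=
  PT.sum_map (f := fun _ (j : Job k) => ∑ i, j.gain i) .id
    (PT.comp (g := fun j : Job k => ∑ i, j.gain i) (.sum _ fun i => .gain i) .snd_aux)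

/-- A single step may multiply the length of the table before pruning, so step-by-step growth bounds
are useless. Instead `GoodTable` bounds the number and the length of the entries at all times. -/
theorem PT.table {k : ℕ} (c : ℕ) : PT fun x : ℕ × Packing k => table c x.1 x.2 := by
  have hlen : PT fun x : ℕ × Packing k => x.2.length := .length .snd_aux
  have hM : PT fun x : ℕ × Packing k => c * x.2.length := .mul (.const _) hlen
  have hcopies : PT fun x : ℕ × Packing k => (ServerPlacement.copies c x.2).map
      fun _ => ((k, []) : Bin) := .map (f := fun _ _ => (k, [])) (.copies .snd_aux c) (.const _)
  have hn : PolyBdd fun x : ℕ × Packing k => x.2.length :=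
    PolyBdd.self.mono fun x => (length_le_len x.2).trans (by
      obtain ⟨u, I⟩ := x; simp; omega)
  have hMb : PolyBdd fun x : ℕ × Packing k => c * x.2.length := (PolyBdd.const c).mul hn
  have hBb : PolyBdd fun x : ℕ × Packing k => (c * x.2.length + 1) ^ (k + 1) :=
    (hMb.add (.const 1)).pow _
  have hV : PT fun x : ℕ × Packing k => x.1 * ServerPlacement.totalGain x.2 *
      (k * (c * x.2.length)) :=
    .mul (.mul .fst_aux (PT.totalGain.comp .snd_aux)) (.mul (.const _) hM)
  refine PT.foldl_of_inv (l := fun x : ℕ × Packing k => ServerPlacement.steps c x.2)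
    (step := fun (x : ℕ × Packing k) T y =>
      ServerPlacement.tableStep (c * x.2.length + 1, x.1) T y) ((PT.steps c).comp .snd_aux)
    (start := fun x : ℕ × Packing k => [(c * x.2.length * (c * x.2.length + 1) ^ k, 0,
      (ServerPlacement.copies c x.2).map fun _ => (k, []))])
    (.cons (.prodMk (.mul hM (.pow (.add hM (.const 1)) k)) (.prodMk (.const _) hcopies))
      (.const _))
    (PT.tableStep.comp (f := fun x : (ℕ × Packing k) × List State × (ℕ × Job k × ℕ) =>
      ((c * x.1.2.length + 1, x.1.1), x.2)) (.prodMk (.prodMk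
        (.add (hM.comp .fst_aux) (.const 1)) (by fun_prop)) (by fun_prop)))
    (fun x _ T => GoodTable c x.1 x.2 T) (fun x => goodTable_start c x.1 x.2)
    (fun x T y m h hm => h.tableStep (mem_steps (hm.subset List.mem_cons_self)))
    (b := fun x => (c * x.2.length + 1) ^ (k + 1) * (((c * x.2.length + 1) ^ (k + 1) + 1) +
      (len (x.1 * ServerPlacement.totalGain x.2 * (k * (c * x.2.length))) + (c * x.2.length *
      ((k + 1) + (k * (((x.2.length + 1) + (k + 1) + 1) + 1) + 1) + 1 + 1) + 1) + 1) + 1 + 1) + 1)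
    ?_ fun x m T h => len_list_le h.length_le fun s hs => (h.2 s hs).len_le
  refine (hBb.mul (((((hBb.add (.const 1)).add ((hV.bdd.add (.add (hMb.mul ?_)
    (.const 1))).add (.const 1))).add (.const 1)).add (.const 1)))).add (.const 1)
  refine .add (.add (.add (.const _) (.add (.mul (.const _) (.add (.add (.add (.add hn ?_) ?_)
    ?_) ?_)) ?_)) ?_) ?_ <;> exact .const _

theorem PT.best : PT best := by
  have : PT fun T : List State => T.foldl (fun s t => if s.1 ≤ t.1 then t else s) (0, 0, []) := by
    refine PT.foldl (step := fun _ (s t : State) => if s.1 ≤ t.1 then t else s)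
      (b := fun x => len x.2) .id (.const _) (.ite_le ?_ ?_ ?_ ?_)
      (PT.bdd (f := fun x : List State × State => x.2) (by fun_prop)) fun a s x => ?_
    any_goals fun_prop
    dsimp only
    split_ifs <;> omega
  exact this

theorem PT.coarse {k : ℕ} : PT fun I : Packing (k + 1) => coarse I :=
  PT.sum_map (f := fun _ (j : Job (k + 1)) => (j.target + j.gain (Fin.last k) - 1) /
    j.gain (Fin.last k)) .id (by fun_prop)

theorem PT.bundle {k : ℕ} (E : ℕ) : PT fun I : Packing (k + 1) => bundle E I := by
  have : PT fun I : Packing (k + 1) => ServerPlacement.coarse I / (E * I.length) :=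
    .div .coarse (.mul (.const _) (.length .id))
  exact .ite_eq this (.const 0) (.const 1) this

theorem PT.scheme {k : ℕ} (E c : ℕ) : PT fun I : Packing (k + 1) => scheme E c I :=
  .map (f := fun (I : Packing (k + 1)) (m : Bin) => (ServerPlacement.bundle E I, m.2))
    (PT.best.comp ((PT.table c).comp ((PT.bundle E).prodMk .id))).snd.snd
    (.prodMk ((PT.bundle E).comp .fst_aux) (by fun_prop))

end ServerPlacement

namespace ServerPlacement

/-! ### Keys -/

theorem sum_mul_pow_lt {B : ℕ} {f : ℕ → ℕ} (hf : ∀ i, f i < B) (n : ℕ) :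
    ∑ i ∈ Finset.range n, f i * B ^ i < B ^ n := by
  induction n with
  | zero => simp
  | succ n ih =>
    rw [Finset.sum_range_succ, pow_succ]
    have := hf n
    have : (f n + 1) * B ^ n ≤ B * B ^ n := Nat.mul_le_mul_right _ this
    rw [Nat.add_one_mul] at this
    rw [mul_comm (B ^ n)]
    omega

/-- The lower digits of the larger number amount to less than `B ^ n`, so they cannot make up for a
smaller leading digit. -/
theorem le_of_sum_mul_pow_le {B : ℕ} {f g : ℕ → ℕ} (hg : ∀ i, g i < B) {n : ℕ}
    (h : ∑ i ∈ Finset.range (n + 1), f i * B ^ i ≤ ∑ i ∈ Finset.range (n + 1), g i * B ^ i) :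
    f n ≤ g n := by
  rw [Finset.sum_range_succ, Finset.sum_range_succ] at h
  have h1 := sum_mul_pow_lt hg n
  by_contra! h2
  have : (g n + 1) * B ^ n ≤ f n * B ^ n := Nat.mul_le_mul_right _ h2
  rw [Nat.add_one_mul] at this
  omega

theorem eq_of_sum_mul_pow_eq {B : ℕ} {f g : ℕ → ℕ} (hf : ∀ i, f i < B) (hg : ∀ i, g i < B) {n : ℕ}
    (h : ∑ i ∈ Finset.range n, f i * B ^ i = ∑ i ∈ Finset.range n, g i * B ^ i) :
    ∀ i < n, f i = g i := by
  induction n with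
  | zero => simp
  | succ n ih =>
    have h1 : f n = g n := (le_of_sum_mul_pow_le hg h.le).antisymm (le_of_sum_mul_pow_le hf h.ge)
    rw [Finset.sum_range_succ, Finset.sum_range_succ, h1] at h
    intro i hi
    rcases Nat.lt_succ_iff_lt_or_eq.1 hi with hi | rfl
    · exact ih (by omega) i hi
    · exact h1

/-- The numbers of unused processors of the machines. -/
def rems (s : State) : Multiset ℕ := (s.2.2.map Prod.fst : List ℕ)

section
variable {k M n W : ℕ} {s t : State}

theorem Good.le_of_mem_rems (h : Good k M n W s) {r : ℕ} (hr : r ∈ rems s) : r ≤ k := by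
  obtain ⟨m, hm, rfl⟩ := List.mem_map.1 (Multiset.mem_coe.1 hr)
  have := h.sum_eq m hm
  omega

theorem Good.count_lt (h : Good k M n W s) (r : ℕ) : (rems s).count r < M + 1 := by
  have := Multiset.count_le_card r (rems s)
  simp [rems, h.length_eq] at this ⊢
  omega

theorem Good.key_eq_sum (h : Good k M n W s) :
    s.1 = ∑ r ∈ Finset.range (k + 1), (rems s).count r * (M + 1) ^ r := by
  have h1 : s.1 = ((rems s).map fun r => (M + 1) ^ r).sum := by
    rw [h.key_eq]; simp [rems, Function.comp_def]
  rw [h1, Finset.sum_multiset_map_count]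
  refine Finset.sum_subset (fun r hr => ?_) fun r _ hr => ?_
  · have := h.le_of_mem_rems (Multiset.mem_toFinset.1 hr)
    exact Finset.mem_range.2 (by omega)
  · rw [Multiset.mem_toFinset] at hr
    simp [Multiset.count_eq_zero_of_notMem hr]

/-- The digits of the key in base `M + 1` are the multiplicities of the remainders. Hence pruning by
key compares only placements that can be continued in the same ways. -/
theorem Good.rems_eq (hs : Good k M n W s) (ht : Good k M n W t) (h : s.1 = t.1) :
    rems s = rems t := by
  rw [hs.key_eq_sum, ht.key_eq_sum] at h
  have := eq_of_sum_mul_pow_eq hs.count_lt ht.count_lt h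
  ext r
  by_cases hr : r < k + 1
  · exact this r hr
  · rw [Multiset.count_eq_zero_of_notMem fun h' => hr (by have := hs.le_of_mem_rems h'; omega),
      Multiset.count_eq_zero_of_notMem fun h' => hr (by have := ht.le_of_mem_rems h'; omega)]

/-- The leading digit of the key counts the machines with all `k` processors unused, so a largest
key means a cheapest placement. -/
theorem Good.count_le (hs : Good k M n W s) (ht : Good k M n W t) (h : s.1 ≤ t.1) :
    (rems s).count k ≤ (rems t).count k := by
  rw [hs.key_eq_sum, ht.key_eq_sum] at h
  exact le_of_sum_mul_pow_le ht.count_lt h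

end

/-! ### The table, job by job -/

/-- The treatment of one job. -/
def jobStep {k : ℕ} (c : ℕ × ℕ) (m : ℕ) (T : List State) (x : Job k × ℕ) : List State :=
  finish x.1 ((expand (c, x))^[m] T)

theorem table_eq {k : ℕ} (c u : ℕ) (I : Packing k) : table c u I =
    I.zipIdx.foldl (jobStep (c * I.length + 1, u) (k * c * I.length))
    [(c * I.length * (c * I.length + 1) ^ k, 0, (copies c I).map fun _ => (k, []))] := by
  have : ∀ (x : Job k × ℕ) (l : List (Job k)) (T : List State),
      (l.map fun _ => (0, x)).foldl (tableStep (c * I.length + 1, u)) T =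
      (expand ((c * I.length + 1, u), x))^[l.length] T := by
    intro x l
    induction l with
    | nil => simp
    | cons a l ih =>
      intro T
      rw [List.map_cons, List.foldl_cons, ih, List.length_cons, Function.iterate_succ_apply]
      rfl
  rw [table, steps, List.foldl_flatMap]
  congr 1
  funext T x
  rw [List.foldl_append, this, length_copies]
  rfl

section
variable {k c u : ℕ} {I : Packing k}

theorem GoodTable.iterate {T : List State} (h : GoodTable c u I T)
    {x : Job k × ℕ} (hx : x ∈ I.zipIdx) (m : ℕ) :
    GoodTable c u I ((ServerPlacement.expand ((c * I.length + 1, u), x))^[m] T) := by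
  induction m with
  | zero => exact h
  | succ m ih => rw [Function.iterate_succ_apply']; exact ih.expand hx

theorem GoodTable.jobStep {T : List State} (h : GoodTable c u I T)
    {x : Job k × ℕ} (hx : x ∈ I.zipIdx) (m : ℕ) :
    GoodTable c u I (jobStep (c * I.length + 1, u) m T x) :=
  (h.iterate hx m).finish _

/-! ### Soundness -/

/-- The gain of a block of `p` processors. -/
def Job.gainAt (j : Job k) (p : ℕ) : ℕ := if h : p - 1 < k then j.gain ⟨p - 1, h⟩ else 0

theorem Job.gainAt_succ (j : Job k) (i : Fin k) : j.gainAt (i + 1) = j.gain i := by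
  simp [Job.gainAt]

/-- The amount by which the demand of the job number `i` is satisfied. -/
def binAmount (x : Job k × ℕ) (ms : List Bin) : ℕ :=
  (ms.map fun m => (m.2.map fun b => if b.1 = x.2 then x.1.gainAt b.2 else 0).sum).sum

theorem binAmount_extend {i : Fin k} {e : ℕ} {c : (ℕ × ℕ) × Job k × ℕ} {s t : State}
    (h : t ∈ extend i e c s) (x : Job k × ℕ) : binAmount x t.2.2 = binAmount x s.2.2 +
      if c.2.2 = x.2 then x.1.gain i else 0 := by
  obtain ⟨-, -, m, rest, h3, h4⟩ := extend_spec h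
  rw [binAmount, binAmount, (h3.map _).sum_eq, (h4.map _).sum_eq]
  simp only [List.map_cons, List.sum_cons, Job.gainAt_succ]
  omega

/-- The demands of certain jobs are satisfied up to a factor of `u`. -/
def Satisfies (u : ℕ) (D : List (Job k × ℕ)) (s : State) : Prop :=
  ∀ y ∈ D, y.1.target ≤ u * binAmount y s.2.2

/-- The recorded value never exceeds what the blocks really give to `x`, and adding blocks cannot
spoil the jobs in `D` that are already served. -/
theorem sound_iterate {D : List (Job k × ℕ)} {B : ℕ} {x : Job k × ℕ} {T : List State}
    (h : ∀ s ∈ T, s.2.1 ≤ u * binAmount x s.2.2 ∧ Satisfies u D s) (m : ℕ) :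
    ∀ s ∈ (expand ((B, u), x))^[m] T, s.2.1 ≤ u * binAmount x s.2.2 ∧ Satisfies u D s := by
  induction m with
  | zero => exact h
  | succ m ih =>
    rw [Function.iterate_succ_apply']
    intro t ht
    rcases mem_expand ht with ht | ⟨s, hs, ht⟩
    · exact ih t ht
    · obtain ⟨i, e, -, ht⟩ := mem_extensions.1 ht
      obtain ⟨h1, h2⟩ := ih s hs
      refine ⟨?_, fun y hy => (h2 y hy).trans ?_⟩
      · rw [(extend_spec ht).2.1, binAmount_extend ht x, if_pos rfl, mul_add]
        exact Nat.add_le_add_right h1 _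
      · rw [binAmount_extend ht y]
        exact Nat.mul_le_mul_left _ (Nat.le_add_right _ _)

theorem sound_foldl {B m : ℕ} (l : List (Job k × ℕ)) {D : List (Job k × ℕ)} {T : List State}
    (h : ∀ s ∈ T, s.2.1 = 0 ∧ Satisfies u D s) :
    ∀ s ∈ l.foldl (jobStep (B, u) m) T, Satisfies u (D ++ l) s := by
  induction l generalizing D T with
  | nil => simpa using fun s hs => (h s hs).2
  | cons x l ih =>
    have := @ih (D ++ [x]) (jobStep (B, u) m T x) fun t ht => by
      obtain ⟨s, hs, h1, rfl⟩ := mem_finish.1 ht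
      obtain ⟨h2, h3⟩ := sound_iterate (fun s hs => ⟨by simp [(h s hs).1], (h s hs).2⟩) m s hs
      refine ⟨rfl, fun y hy => ?_⟩
      rcases List.mem_append.1 hy with hy | hy
      · exact h3 y hy
      · obtain rfl := List.mem_singleton.1 hy
        exact h1.trans h2
    simpa using this

theorem sound_table {s : State} (hs : s ∈ table c u I) : Satisfies u I.zipIdx s := by
  rw [table_eq] at hs
  simpa using sound_foldl (D := []) _ (by simp [Satisfies]) s hs

/-! ### Completeness -/

/-- The table has an entry with the given numbers of unused processors that is at least as good
as `v`. -/
def Has (T : List State) (R : Multiset ℕ) (v : ℕ) : Prop := ∃ s ∈ T, rems s = R ∧ v ≤ s.2.1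

theorem GoodTable.has_expand_of {T : List State} (hT : GoodTable c u I T) {x : Job k × ℕ}
    (hx : x ∈ I.zipIdx) {R : Multiset ℕ} {v : ℕ}
    (h : Has (T ++ T.flatMap (extensions ((c * I.length + 1, u), x))) R v) :
    Has (ServerPlacement.expand ((c * I.length + 1, u), x) T) R v := by
  obtain ⟨s, hs, rfl, h2⟩ := h
  obtain ⟨t, ht, h3, h4⟩ := (prune_spec _).2.1 s hs
  have hs' : Good k (c * I.length) I.length (u * totalGain I) s := by
    rcases List.mem_append.1 hs with hs | hs
    · exact hT.2 s hs
    · obtain ⟨r, hr, hs⟩ := List.mem_flatMap.1 hs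
      obtain ⟨i, e, -, hs⟩ := mem_extensions.1 hs
      have h1 := List.fst_mem_of_mem_zipIdx hx
      have h2 := List.snd_lt_of_mem_zipIdx hx
      exact (hT.2 r hr).extend rfl (by simpa using h2)
        (Nat.mul_le_mul_left _ (gain_le_totalGain h1 i)) hs
  exact ⟨t, ht, ((hT.expand hx).2 t ht).rems_eq hs' h3, h2.trans h4⟩

theorem GoodTable.has_expand {T : List State} (hT : GoodTable c u I T) {x : Job k × ℕ}
    (hx : x ∈ I.zipIdx) {R : Multiset ℕ} {v : ℕ} (h : Has T R v) :
    Has (ServerPlacement.expand ((c * I.length + 1, u), x) T) R v :=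
  hT.has_expand_of hx (by
    obtain ⟨s, hs, h⟩ := h
    exact ⟨s, List.mem_append_left _ hs, h⟩)

/-- Machines with equally many unused processors are interchangeable, so it does not matter which of
them `putBlock` picks. -/
theorem GoodTable.has_expand_cons {T : List State} (hT : GoodTable c u I T) {x : Job k × ℕ}
    (hx : x ∈ I.zipIdx) {R : Multiset ℕ} {v e : ℕ} {i : Fin k} (h : Has T ((e + (i + 1)) ::ₘ R) v) :
    Has (ServerPlacement.expand ((c * I.length + 1, u), x) T) (e ::ₘ R) (v + u * x.1.gain i) := by
  refine hT.has_expand_of hx ?_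
  obtain ⟨s, hs, h1, h2⟩ := h
  have hr : e + (↑i + 1) ∈ rems s := by rw [h1]; exact Multiset.mem_cons_self _ _
  have he := (hT.2 s hs).le_of_mem_rems hr
  have hne : (putBlock (e + (i + 1)) e (x.2, (i : ℕ) + 1) s.2.2).1 ≠ 0 := by
    rcases putBlock_eq_zero_or (e + (i + 1)) e (x.2, (i : ℕ) + 1) s.2.2 with h3 | h3
    · exact absurd (Multiset.mem_coe.1 hr) h3.2
    · exact h3.1
  have hmem : (s.1 + (c * I.length + 1) ^ e - (c * I.length + 1) ^ (e + (i + 1)),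
      s.2.1 + u * x.1.gain i, (putBlock (e + (i + 1)) e (x.2, (i : ℕ) + 1) s.2.2).2) ∈
      ServerPlacement.extend i e ((c * I.length + 1, u), x) s := by
    rw [ServerPlacement.extend, if_pos hne]
    exact List.mem_singleton_self _
  refine ⟨_, List.mem_append_right _ (List.mem_flatMap.2
    ⟨s, hs, mem_extensions.2 ⟨i, e, by omega, hmem⟩⟩), ?_, Nat.add_le_add_right h2 _⟩
  obtain ⟨-, -, m, rest, h3, h4⟩ := extend_spec hmem
  have h5 : rems s = (e + (i + 1)) ::ₘ (rest.map Prod.fst : List ℕ) :=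
    Multiset.coe_eq_coe.2 (h3.map Prod.fst)
  rw [h5, Multiset.cons_inj_right] at h1
  rw [← h1]
  exact Multiset.coe_eq_coe.2 (h4.map Prod.fst)

theorem GoodTable.has_iterate_le {T : List State} (hT : GoodTable c u I T) {x : Job k × ℕ}
    (hx : x ∈ I.zipIdx) {R : Multiset ℕ} {v m m' : ℕ} (hm : m ≤ m')
    (h : Has ((ServerPlacement.expand ((c * I.length + 1, u), x))^[m] T) R v) :
    Has ((ServerPlacement.expand ((c * I.length + 1, u), x))^[m'] T) R v := by
  induction m', hm using Nat.le_induction with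
  | base => exact h
  | succ m' _ ih =>
    rw [Function.iterate_succ_apply']
    exact (hT.iterate hx m').has_expand hx ih

variable {n : ℕ}

/-- The number of processors that a machine dedicates to the jobs with a given property. -/
def Machine.used (M : Machine n k) (p : ℕ → Prop) [DecidablePred p] : ℕ :=
  (M.map fun b => if p b.job then b.size else 0).sum

/-- The amount by which a machine satisfies the demand of the job number `x.2`. -/
def Machine.gain (M : Machine n k) (x : Job k × ℕ) : ℕ :=
  (M.map fun b => if (b.job : ℕ) = x.2 then x.1.gain b.idx else 0).sum

/-- One round is spent on each block of `M`. Rounds for blocks of other jobs are idle, since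
`expand` never loses what the table already has. -/
theorem GoodTable.has_machine {T : List State} (hT : GoodTable c u I T) {x : Job k × ℕ}
    (hx : x ∈ I.zipIdx) {R : Multiset ℕ} {v r : ℕ} (M : Machine n k)
    (h : Has T ((r + M.used (· = x.2)) ::ₘ R) v) :
    Has ((ServerPlacement.expand ((c * I.length + 1, u), x))^[M.length] T) (r ::ₘ R)
      (v + u * M.gain x) := by
  induction M generalizing T v with
  | nil => simpa [Machine.used, Machine.gain] using h
  | cons b M ih =>
    have h1 : Machine.used (b :: M) (· = x.2) =
      (if (b.job : ℕ) = x.2 then b.size else 0) + Machine.used M (· = x.2) := rfl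
    have h2 : Machine.gain (b :: M) x =
      (if (b.job : ℕ) = x.2 then x.1.gain b.idx else 0) + Machine.gain M x := rfl
    rw [List.length_cons, Function.iterate_succ_apply]
    rw [h1] at h
    rw [h2, mul_add, ← add_assoc]
    refine ih (hT.expand hx) ?_
    split_ifs at h ⊢ with hb
    · refine hT.has_expand_cons hx ?_
      convert h using 2
      simp only [Block.size]; omega
    · simpa using hT.has_expand hx h

theorem GoodTable.has_machines {T : List State} (hT : GoodTable c u I T) {x : Job k × ℕ}
    (hx : x ∈ I.zipIdx) {R : Multiset ℕ} {v : ℕ} (Q : List (Machine n k))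
    {r r' : Machine n k → ℕ} (hr : ∀ M ∈ Q, r M = r' M + M.used (· = x.2))
    (h : Has T ((Q.map r : List ℕ) + R) v) :
    Has ((ServerPlacement.expand ((c * I.length + 1, u), x))^[(Q.map List.length).sum] T)
      ((Q.map r' : List ℕ) + R) (v + u * (Q.map fun M => M.gain x).sum) := by
  induction Q generalizing T R v with
  | nil => simpa using h
  | cons M Q ih =>
    rw [List.map_cons, hr M (by simp), ← Multiset.cons_coe, Multiset.cons_add] at h
    have h1 := hT.has_machine hx M h
    rw [← Multiset.add_cons] at h1
    have h2 := ih (hT.iterate hx _) (fun M hM => hr M (List.mem_cons_of_mem _ hM)) h1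
    rw [← Function.iterate_add_apply, Multiset.add_cons, ← Multiset.cons_add,
      Multiset.cons_coe] at h2
    simp only [List.map_cons, List.sum_cons]
    rwa [mul_add, ← add_assoc, add_comm M.length]

theorem Machine.length_le_sum (M : Machine n k) : M.length ≤ (M.map Block.size).sum := by
  have := List.card_nsmul_le_sum (M.map Block.size) 1 (by
    intro x hx
    obtain ⟨b, hb, rfl⟩ := List.mem_map.1 hx
    simp [Block.size])
  simpa using this

theorem Machine.used_le (M : Machine n k) (p : ℕ → Prop) [DecidablePred p] :
    M.used p ≤ (M.map Block.size).sum := by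
  refine List.sum_le_sum fun b _ => ?_
  split_ifs <;> simp

theorem Machine.used_lt_succ (M : Machine n k) (a : ℕ) :
    M.used (· < a + 1) = M.used (· < a) + M.used (· = a) := by
  simp only [Machine.used, ← List.sum_map_add]
  congr 2
  funext b
  split_ifs <;> omega

theorem GoodTable.has_jobStep {T : List State} (hT : GoodTable c u I T) {x : Job k × ℕ}
    (hx : x ∈ I.zipIdx) {Q : List (Machine n k)} (hQ : Q.length = c * I.length)
    (hfit : ∀ M ∈ Q, M.Fits) (hd : x.1.target ≤ u * (Q.map fun M => M.gain x).sum)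
    (h : Has T (Q.map fun M => k - M.used (· < x.2) : List ℕ) 0) :
    Has (ServerPlacement.jobStep (c * I.length + 1, u) (k * c * I.length) T x)
      (Q.map fun M => k - M.used (· < x.2 + 1) : List ℕ) 0 := by
  have h1 := hT.has_machines hx (R := 0) Q (r := fun M => k - M.used (· < x.2)) (r' := fun M => k - M.used (· < x.2 + 1)) (fun M hM => by
    have h2 := M.used_le (· < x.2 + 1)
    have h3 : (M.map Block.size).sum ≤ k := hfit M hM
    rw [M.used_lt_succ] at h2 ⊢
    omega) (by simpa using h)
  -- Each block takes up a processor, so the fixed number of rounds is at least the number of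
  -- blocks.
  have h2 : (Q.map List.length).sum ≤ k * c * I.length := by
    have := List.sum_le_card_nsmul (Q.map List.length) k (by
      intro y hy
      obtain ⟨M, hM, rfl⟩ := List.mem_map.1 hy
      exact (Machine.length_le_sum M).trans (hfit M hM))
    rw [List.length_map, hQ, smul_eq_mul] at this
    exact this.trans (by rw [mul_comm, mul_assoc])
  obtain ⟨s, hs, h3, h4⟩ := hT.has_iterate_le hx h2 h1
  exact ⟨_, mem_finish.2 ⟨s, hs, hd.trans (by simpa using h4), rfl⟩, h3.trans (by simp), le_rfl⟩

theorem GoodTable.has_foldl {Q : List (Machine n k)} (hQ : Q.length = c * I.length)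
    (hfit : ∀ M ∈ Q, M.Fits) (l : List (Job k)) (a : ℕ) {T : List State} (hT : GoodTable c u I T)
    (hl : ∀ x ∈ l.zipIdx a, x ∈ I.zipIdx ∧ x.1.target ≤ u * (Q.map fun M => M.gain x).sum)
    (h : Has T (Q.map fun M => k - M.used (· < a) : List ℕ) 0) :
    Has ((l.zipIdx a).foldl (ServerPlacement.jobStep (c * I.length + 1, u) (k * c * I.length)) T)
      (Q.map fun M => k - M.used (· < a + l.length) : List ℕ) 0 := by
  induction l generalizing a T with
  | nil => simpa using h
  | cons j l ih =>
    rw [List.zipIdx_cons] at hl ⊢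
    obtain ⟨h1, h2⟩ := hl (j, a) (by simp)
    have := ih (a + 1) (hT.jobStep h1 _) (fun x hx => hl x (List.mem_cons_of_mem _ hx))
      (hT.has_jobStep h1 hQ hfit h2 h)
    simpa [add_assoc, add_comm 1] using this

/-- The table has an entry for every placement that satisfies all demands up to a factor of `u`. -/
theorem has_table {Q : List (Machine I.length k)} (hQ : Q.length = c * I.length)
    (hfit : ∀ M ∈ Q, M.Fits)
    (hd : ∀ x ∈ I.zipIdx, x.1.target ≤ u * (Q.map fun M => M.gain x).sum) :
    Has (table c u I) (Q.map fun M => k - (M.map Block.size).sum : List ℕ) 0 := by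
  rw [table_eq]
  have := (goodTable_start c u I).has_foldl hQ hfit I 0 (fun x hx => ⟨hx, hd x hx⟩)
    ⟨_, List.mem_singleton_self _, by
      simp [rems, Machine.used, length_copies, hQ], le_rfl⟩
  simpa [Machine.used] using this

end

end ServerPlacement

namespace ServerPlacement

/-! ### Rounding a placement to bundles of equal machines -/

section
variable {α : Type} [DecidableEq α]

/-- The multiset with the multiplicities `f a` of the elements of `s`. -/
def withCounts (s : Finset α) (f : α → ℕ) : Multiset α :=
  ∑ a ∈ s, Multiset.replicate (f a) a

theorem count_withCounts (s : Finset α) (f : α → ℕ) (a : α) :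
    (withCounts s f).count a = if a ∈ s then f a else 0 := by
  simp [withCounts, Multiset.count_sum', Multiset.count_replicate]

/-- Division of all multiplicities, rounded up. -/
theorem exists_le_nsmul (s : Multiset α) {u : ℕ} (hu : 0 < u) : ∃ t : Multiset α,
    s ≤ u • t ∧ (∀ a ∈ t, a ∈ s) ∧ u * t.card ≤ s.card + s.toFinset.card * u := by
  refine ⟨withCounts s.toFinset fun a => s.count a / u + 1, ?_, fun a ha => ?_, ?_⟩
  · rw [Multiset.le_iff_count]
    intro a
    rw [Multiset.count_nsmul, count_withCounts]
    split_ifs with h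
    · exact (Nat.lt_mul_div_succ _ hu).le
    · rw [Multiset.mem_toFinset] at h
      simp [Multiset.count_eq_zero_of_notMem h]
  · by_contra h
    rw [← Multiset.count_pos, count_withCounts, if_neg (by simpa using h)] at ha
    simp at ha
  · have : (withCounts s.toFinset fun a => s.count a / u + 1).card =
        ∑ a ∈ s.toFinset, (s.count a / u + 1) := by simp [withCounts]
    rw [this, Finset.mul_sum, ← Multiset.toFinset_sum_count_eq, ← smul_eq_mul (_ : ℕ) u,
      ← Finset.sum_const, ← Finset.sum_add_distrib]
    refine Finset.sum_le_sum fun a _ => ?_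
    have := Nat.mul_div_le (s.count a) u
    rw [mul_add]; omega

/-- Division of all multiplicities, rounded down. -/
theorem exists_nsmul_le (s : Multiset α) {u : ℕ} (hu : 0 < u) : ∃ t : Multiset α,
    u • t ≤ s ∧ ∀ a, s.count a ≤ u * (t.count a + 1) := by
  have h : ∀ a, (withCounts s.toFinset fun a => s.count a / u).count a = s.count a / u := by
    intro a
    rw [count_withCounts]
    split_ifs with h
    · rfl
    · rw [Multiset.mem_toFinset] at h
      simp [Multiset.count_eq_zero_of_notMem h]
  refine ⟨withCounts s.toFinset fun a => s.count a / u, ?_, fun a => ?_⟩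
  · rw [Multiset.le_iff_count]
    intro a
    rw [Multiset.count_nsmul, h]
    exact Nat.mul_div_le _ _
  · rw [h]
    exact (Nat.lt_mul_div_succ _ hu).le

end

/-! ### Filling slots with blocks -/

section
variable {α β : Type} [DecidableEq β]

/-- Greedy filling: each slot takes any remaining object of its kind and stays empty if there is
none. -/
theorem exists_fill (f : α → β) (c : List β) (D : Multiset α) : ∃ (M : List α) (D' : Multiset α),
    (M.map f).Sublist c ∧ D = (M : Multiset α) + D' ∧ D'.map f = D.map f - c := by
  induction c generalizing D with
  | nil => exact ⟨[], D, by simp, by simp, by simp⟩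
  | cons b c ih =>
    rw [← Multiset.cons_coe, ← Multiset.singleton_add]
    by_cases h : b ∈ D.map f
    · obtain ⟨a, ha, rfl⟩ := Multiset.mem_map.1 h
      obtain ⟨D, rfl⟩ := Multiset.exists_cons_of_mem ha
      obtain ⟨M, D', h1, h2, h3⟩ := ih D
      refine ⟨a :: M, D', h1.cons_cons _, ?_, ?_⟩
      · rw [← Multiset.cons_coe, Multiset.cons_add, ← h2]
      · rw [h3, ← tsub_tsub, Multiset.map_cons, Multiset.sub_singleton, Multiset.erase_cons_head]
    · obtain ⟨M, D', h1, h2, h3⟩ := ih D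
      refine ⟨M, D', h1.cons _, h2, ?_⟩
      rw [h3, ← tsub_tsub, Multiset.sub_singleton, Multiset.erase_of_notMem h]

/-- Slots of given kinds can be filled with objects if there are enough slots of each kind. -/
theorem exists_fill_all (f : α → β) (R : List (List β)) (D : Multiset α) :
    ∃ (Q : List (List α)) (D' : Multiset α), List.Forall₂ (fun M c => (M.map f).Sublist c) Q R ∧
      D = (Q.flatten : Multiset α) + D' ∧ D'.map f = D.map f - (R.flatten : Multiset β) := by
  induction R generalizing D with
  | nil => exact ⟨[], D, by simp, by simp, by simp⟩
  | cons c R ih =>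
    obtain ⟨M, D₁, h1, h2, h3⟩ := exists_fill f c D
    obtain ⟨Q, D₂, h4, h5, h6⟩ := ih D₁
    refine ⟨M :: Q, D₂, .cons h1 h4, ?_, ?_⟩
    · rw [List.flatten_cons, ← Multiset.coe_add, add_assoc, ← h5, h2]
    · rw [h6, h3, List.flatten_cons, ← Multiset.coe_add, tsub_tsub]

end

/-- The number of possible shapes of a machine, counted with the order of the blocks. -/
noncomputable def shapeCount (k : ℕ) : ℕ := (List.finite_length_le (Fin k) k).toFinset.card

section
variable {n k : ℕ}

/-- The multiplicities of machine shapes are divided by `u` and rounded up, those of blocks (job and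
size) are divided by `u` and rounded down. The reduced blocks then fit into the slots of the reduced
shapes. Rounding up costs at most one machine per shape, and what rounding down loses is restored by
one machine for each job and size. -/
theorem exists_rounding (P : Placement n k) (hP : ∀ M ∈ P, M.Fits) {u : ℕ} (hu : 0 < u) :
    ∃ Q : Placement n k, (∀ M ∈ Q, M.Fits) ∧
      (P.flatten : Multiset (Block n k)) ≤ u • (Q.flatten : Multiset (Block n k)) ∧
      u * Q.length ≤ P.length + (shapeCount k + n * k) * u := by
  classical
  set S : Multiset (List (Fin k)) := ((P.map fun M => M.map Block.idx : List (List (Fin k))) : Multiset (List (Fin k))) with hS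
  have hfit : ∀ c ∈ S, (c.map fun i : Fin k => (i : ℕ) + 1).sum ≤ k := by
    intro c hc
    obtain ⟨M, hM, rfl⟩ := List.mem_map.1 (Multiset.mem_coe.1 hc)
    rw [List.map_map]
    exact hP M hM
  have hcard : S.toFinset.card ≤ shapeCount k := by
    refine Finset.card_le_card fun c hc => ?_
    obtain ⟨M, hM, rfl⟩ := List.mem_map.1 (Multiset.mem_coe.1 (Multiset.mem_toFinset.1 hc))
    simpa using (Machine.length_le_sum M).trans (hP M hM)
  obtain ⟨T, hT, hTS, hTc⟩ := exists_le_nsmul S hu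
  obtain ⟨D, hD, hDc⟩ := exists_nsmul_le (P.flatten : Multiset (Block n k)) hu
  -- For each size, `u` times the reduced blocks are at most the blocks of `P`, which are at most
  -- `u` times the slots.
  have hle : D.map Block.idx ≤ (T.toList.flatten : Multiset (Fin k)) := by
    rw [Multiset.le_iff_count]
    intro p
    have h1 := Multiset.count_le_of_le p (Multiset.map_le_map hD (f := Block.idx))
    rw [Multiset.map_nsmul, Multiset.count_nsmul] at h1
    have h2 : Multiset.count p ((P.flatten : Multiset (Block n k)).map Block.idx) =
        (S.map fun c => c.count p).sum := by
      simp [hS, List.count_flatten, List.map_flatten, Function.comp_def]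
    have h3 : (S.map fun c => c.count p).sum ≤ u * (T.map fun c => c.count p).sum := by
      rw [← smul_eq_mul, ← Multiset.sum_nsmul, ← Multiset.map_nsmul]
      obtain ⟨w, hw⟩ := Multiset.le_iff_exists_add.1 hT
      rw [hw, Multiset.map_add, Multiset.sum_add]
      exact Nat.le_add_right _ _
    have h4 : Multiset.count p (T.toList.flatten : Multiset (Fin k)) =
        (T.map fun c => c.count p).sum := by
      conv_rhs => rw [← Multiset.coe_toList T]
      simp [List.count_flatten]
    rw [h4]
    exact Nat.le_of_mul_le_mul_left (h1.trans (h2.le.trans h3)) hu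
  obtain ⟨Q, D', hQ, hQD, hD'⟩ := exists_fill_all Block.idx T.toList D
  have hD0 : D' = 0 := by
    rw [tsub_eq_zero_of_le hle] at hD'
    exact Multiset.map_eq_zero.1 hD'
  rw [hD0, add_zero] at hQD
  -- In `u` copies, one additional block of each job and size outweighs the remainder lost by
  -- rounding down.
  set X : Placement n k := (List.finRange n ×ˢ List.finRange k).map fun x => [⟨x.1, x.2⟩] with hX
  refine ⟨Q ++ X, fun M hM => ?_, ?_, ?_⟩
  · rcases List.mem_append.1 hM with hM | hM
    · have : ∀ (Q : List (Machine n k)) (R : List (List (Fin k))),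
          List.Forall₂ (fun M c => (M.map Block.idx).Sublist c) Q R →
          (∀ c ∈ R, (c.map fun i : Fin k => (i : ℕ) + 1).sum ≤ k) → ∀ M ∈ Q, M.Fits := by
        intro Q R h
        induction h with
        | nil => simp
        | @cons M c Q R h _ ih =>
          intro hR M' hM'
          rcases List.mem_cons.1 hM' with rfl | hM'
          · have h1 := ((h.map fun i : Fin k => (i : ℕ) + 1).sum_le_sum (by simp)).trans
              (hR c (by simp))
            rw [List.map_map] at h1
            exact h1
          · exact ih (fun c hc => hR c (List.mem_cons_of_mem _ hc)) M' hM'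
      exact this Q _ hQ (fun c hc => hfit c (hTS c (Multiset.mem_toList.1 hc))) M hM
    · obtain ⟨x, -, rfl⟩ := List.mem_map.1 hM
      simp [Machine.Fits, Block.size]
  · rw [Multiset.le_iff_count]
    intro b
    refine (hDc b).trans ?_
    rw [Multiset.count_nsmul, List.flatten_append, ← Multiset.coe_add, Multiset.count_add, ← hQD]
    have : 0 < Multiset.count b (X.flatten : Multiset (Block n k)) := by
      rw [Multiset.count_pos, Multiset.mem_coe, List.mem_flatten]
      exact ⟨[b], List.mem_map.2 ⟨(b.job, b.idx), by simp, rfl⟩, by simp⟩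
    gcongr
    exact this
  · have h1 : Q.length = T.card := by rw [hQ.length_eq, Multiset.length_toList]
    have h2 : S.card = P.length := by simp [hS]
    have h3 : X.length = n * k := by
      rw [hX, List.length_map, List.length_product, List.length_finRange, List.length_finRange]
    have h4 : S.toFinset.card * u ≤ shapeCount k * u := Nat.mul_le_mul_right _ hcard
    rw [List.length_append, mul_add, h1, h3, add_mul, mul_comm u (n * k)]
    omega

/-! ### Integral amounts -/

/-- The amount by which a placement satisfies the demand of the job number `x.2`. -/
def Placement.gain (P : Placement n k) (x : Job k × ℕ) : ℕ := (P.map fun M => M.gain x).sum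

theorem Placement.gain_eq (P : Placement n k) (x : Job k × ℕ) : P.gain x =
    ((P.flatten : Multiset (Block n k)).map fun b =>
      if (b.job : ℕ) = x.2 then x.1.gain b.idx else 0).sum := by
  simp [Placement.gain, Machine.gain, List.sum_flatten, List.map_flatten, Function.comp_def]

theorem Placement.gain_le_of_le {P Q : Placement n k} {u : ℕ}
    (h : (P.flatten : Multiset (Block n k)) ≤ u • (Q.flatten : Multiset (Block n k)))
    (x : Job k × ℕ) : P.gain x ≤ u * Q.gain x := by
  rw [P.gain_eq, Q.gain_eq, ← smul_eq_mul, ← Multiset.sum_nsmul, ← Multiset.map_nsmul]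
  obtain ⟨w, hw⟩ := Multiset.le_iff_exists_add.1 h
  rw [hw, Multiset.map_add, Multiset.sum_add]
  exact Nat.le_add_right _ _

theorem Placement.length_filter (P : Placement n k) :
    (P.filter fun M => !M.isEmpty).length = Placement.cost P :=
  List.countP_eq_length_filter.symm

theorem Placement.flatten_filter (P : Placement n k) :
    (P.filter fun M => !M.isEmpty).flatten = P.flatten := by
  induction P with
  | nil => rfl
  | cons M P ih => cases M <;> simp [ih]

end

section
variable {k : ℕ} {I : Packing k}

theorem mem_zipIdx_iff {x : Job k × ℕ} :
    x ∈ I.zipIdx ↔ ∃ j : Fin I.length, x = (I.get j, (j : ℕ)) := by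
  obtain ⟨a, i⟩ := x
  rw [List.mem_zipIdx_iff_getElem?, List.getElem?_eq_some_iff]
  constructor
  · rintro ⟨h, h'⟩
    exact ⟨⟨i, h⟩, Prod.ext h'.symm rfl⟩
  · rintro ⟨j, h⟩
    obtain ⟨rfl, rfl⟩ := Prod.mk.inj h
    exact ⟨j.2, rfl⟩

theorem cast_gain (P : Placement I.length k) (j : Fin I.length) :
    (P.gain (I.get j, j) : ℚ≥0) = I.amount j P * (I.get j).scale := by
  rw [Placement.gain, Packing.amount, Nat.cast_list_sum, List.map_map, ← List.sum_map_mul_right]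
  congr 2
  funext M
  simp only [Function.comp, Machine.gain]
  rw [Nat.cast_list_sum, List.map_map, ← List.sum_map_mul_right]
  congr 2
  funext b
  simp only [Function.comp, Packing.blockAmount, Fin.val_inj]
  split_ifs
  · exact Job.gain_eq _ _
  · simp

/-- Both sides are multiplied by the positive common denominator of the job, so the dynamic program
may work with integers. -/
theorem target_le_iff (P : Placement I.length k) (j : Fin I.length) :
    (I.get j).target ≤ P.gain (I.get j, j) ↔ (I.get j).demand ≤ I.amount j P := by
  have h : (0 : ℚ≥0) < (I.get j).scale := by exact_mod_cast (I.get j).scale_pos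
  rw [← Nat.cast_le (α := ℚ≥0), cast_gain, Job.target_eq, mul_le_mul_iff_left₀ h]

theorem feasible_iff (P : Placement I.length k) : I.Feasible P ↔
    (∀ M ∈ P, M.Fits) ∧ ∀ x ∈ I.zipIdx, x.1.target ≤ P.gain x := by
  refine and_congr_right fun _ => ⟨fun h x hx => ?_, fun h j => ?_⟩
  · obtain ⟨j, rfl⟩ := mem_zipIdx_iff.1 hx
    exact (target_le_iff P j).2 (h j)
  · exact (target_le_iff P j).1 (h _ (mem_zipIdx_iff.2 ⟨j, rfl⟩))

end

end ServerPlacement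

namespace ServerPlacement

/-! ### Correctness of the dynamic program -/

section
variable {n k : ℕ}

theorem exists_machines {ms : List Bin} (h : ∀ m ∈ ms, ∀ b ∈ m.2, b.1 < n ∧ 1 ≤ b.2 ∧ b.2 ≤ k) :
    ∃ P : Placement n k, ms.map Prod.snd = P.map fun M => M.map fun b => ((b.job : ℕ), b.size) := by
  have h1 : ∀ bs : List (ℕ × ℕ), (∀ b ∈ bs, b.1 < n ∧ 1 ≤ b.2 ∧ b.2 ≤ k) →
      ∃ M : Machine n k, bs = M.map fun b => ((b.job : ℕ), b.size) := by
    intro bs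
    induction bs with
    | nil => exact fun _ => ⟨[], rfl⟩
    | cons b bs ih =>
      intro hb
      obtain ⟨M, rfl⟩ := ih fun x hx => hb x (List.mem_cons_of_mem _ hx)
      obtain ⟨h2, h3, h4⟩ := hb b (by simp)
      refine ⟨⟨⟨b.1, h2⟩, ⟨b.2 - 1, by omega⟩⟩ :: M, ?_⟩
      simp only [List.map_cons, Block.size, Nat.sub_add_cancel h3]
  induction ms with
  | nil => exact ⟨[], rfl⟩
  | cons m ms ih =>
    obtain ⟨P, hP⟩ := ih fun x hx => h x (List.mem_cons_of_mem _ hx)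
    obtain ⟨M, hM⟩ := h1 m.2 (h m (by simp))
    exact ⟨M :: P, by rw [List.map_cons, hP, hM]; rfl⟩

/-- A compact schedule in which every machine content has the same multiplicity. -/
def Placement.bundled (u : ℕ) (P : Placement n k) : Schedule n k := P.map fun M => (u, M)

/-- The program handles untyped pairs of numbers; their encoding is literally that of a schedule. -/
theorem enc_bundled {ms : List Bin} {P : Placement n k} (u : ℕ)
    (h : ms.map Prod.snd = P.map fun M => M.map fun b => ((b.job : ℕ), b.size)) :
    Enc.enc (ms.map fun m => (u, m.2)) = (P.bundled u).encode := by
  have h1 : ∀ M : Machine n k, Enc.enc (M.map fun b => ((b.job : ℕ), b.size)) =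
      encodeList Block.encode M := by
    intro M
    induction M with
    | nil => rfl
    | cons b M ih => exact congrArg (Data.pair _) ih
  have h2 : ms.map (fun m => (u, m.2)) = (ms.map Prod.snd).map fun l => (u, l) := by
    simp [Function.comp_def]
  rw [h2, h]
  clear h h2
  induction P with
  | nil => rfl
  | cons M P ih =>
    change Data.pair (.pair (.atom u) (Enc.enc (M.map fun b => ((b.job : ℕ), b.size)))) _ =
      Data.pair (.pair (.atom u) (encodeList Block.encode M)) _
    rw [h1]
    exact congrArg (Data.pair _) ih

theorem expand_bundled_cons (u : ℕ) (M : Machine n k) (P : Placement n k) :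
    (Placement.bundled u (M :: P)).expand = List.replicate u M ++ (P.bundled u).expand := rfl

theorem gain_expand_bundled (u : ℕ) (P : Placement n k) (x : Job k × ℕ) :
    Placement.gain (P.bundled u).expand x = u * P.gain x := by
  induction P with
  | nil => rfl
  | cons M P ih =>
    have h1 : Placement.gain (M :: P) x = M.gain x + Placement.gain P x := rfl
    rw [expand_bundled_cons, h1, mul_add, ← ih]
    simp [Placement.gain]

theorem cost_expand_bundled (u : ℕ) (P : Placement n k) :
    Placement.cost (P.bundled u).expand = u * P.cost := by
  induction P with
  | nil => rfl
  | cons M P ih =>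
    have h1 : Placement.cost (M :: P) = Placement.cost P + if !M.isEmpty then 1 else 0 := List.countP_cons
    have h2 : Placement.cost (List.replicate u M ++ (Placement.bundled u P).expand) =
      Placement.cost (List.replicate u M) + Placement.cost (Placement.bundled u P).expand :=
      List.countP_append
    rw [expand_bundled_cons, h1, mul_add, h2, ← ih, add_comm]
    congr 1
    rw [Placement.cost, List.countP_replicate]
    split_ifs <;> simp

/-- Blocks have positive size, so a fitting machine has `k` unused processors exactly if it is
empty. -/
theorem cost_add_count {P : Placement n k} (hP : ∀ M ∈ P, M.Fits) :
    P.cost + (P.map fun M => k - (M.map Block.size).sum).count k = P.length := by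
  induction P with
  | nil => rfl
  | cons M P ih =>
    have h1 := ih fun M hM => hP M (List.mem_cons_of_mem _ hM)
    have h2 : Placement.cost (M :: P) = Placement.cost P + if !M.isEmpty then 1 else 0 := List.countP_cons
    have h3 := Machine.length_le_sum M
    have h4 : (M.map Block.size).sum ≤ k := hP M (by simp)
    rw [h2, List.map_cons, List.count_cons, List.length_cons]
    cases M with
    | nil => simp; omega
    | cons b M =>
      rw [List.length_cons] at h3
      have : k - ((b :: M).map Block.size).sum ≠ k := by omega
      simp only [List.isEmpty_cons, Bool.not_false, if_true, beq_iff_eq, this, if_false]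
      omega

end

section
variable {k c u : ℕ} {I : Packing k}

/-- The dynamic program finds a cheapest placement that satisfies all demands up to a factor
of `u`. -/
theorem best_table {Q : Placement I.length k} (hQ : Q.length ≤ c * I.length)
    (hfit : ∀ M ∈ Q, M.Fits) (hd : ∀ x ∈ I.zipIdx, x.1.target ≤ u * Q.gain x) :
    ∃ S : Schedule I.length k, Enc.enc ((best (table c u I)).2.2.map fun m => (u, m.2)) = S.encode ∧
      I.Feasible S.expand ∧ Placement.cost S.expand ≤ u * Q.cost := by
  -- The table works with exactly `c * I.length` machines; padding with empty ones costs nothing.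
  set Q' : Placement I.length k := Q ++ List.replicate (c * I.length - Q.length) [] with hQ'
  have hlen : Q'.length = c * I.length := by simp [hQ']; omega
  have hcost : Q'.cost = Q.cost := by
    simp [hQ', Placement.cost, List.countP_append, List.countP_replicate]
  have hfit' : ∀ M ∈ Q', M.Fits := by
    intro M hM
    rcases List.mem_append.1 hM with hM | hM
    · exact hfit M hM
    · rw [(List.mem_replicate.1 hM).2]; simp [Machine.Fits]
  obtain ⟨s, hs, hsr, -⟩ := has_table (u := u) hlen hfit' fun x hx => by
    have : (Q'.map fun M => M.gain x).sum = Q.gain x := by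
      simp [hQ', Placement.gain, Machine.gain]
    rw [this]
    exact hd x hx
  obtain ⟨hb, hmax⟩ := best_spec (List.ne_nil_of_mem hs)
  set t := best (table c u I)
  have hgood := goodTable_table c u I
  have ht := hgood.2 t hb
  obtain ⟨P, hP⟩ := exists_machines ht.block
  have hrem : t.2.2.map Prod.fst = P.map fun M => k - (M.map Block.size).sum := by
    have h1 : t.2.2.map Prod.fst = (t.2.2.map Prod.snd).map fun l => k - (l.map Prod.snd).sum := by
      rw [List.map_map]
      refine List.map_congr_left fun m hm => ?_
      have := ht.sum_eq m hm
      simp only [Function.comp]; omega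
    rw [h1, hP, List.map_map]
    simp [Function.comp_def]
  have hfitP : ∀ M ∈ P, M.Fits := by
    intro M hM
    have h1 : (M.map fun b => ((b.job : ℕ), b.size)) ∈ t.2.2.map Prod.snd := by
      rw [hP]; exact List.mem_map_of_mem hM
    obtain ⟨m, hm, h2⟩ := List.mem_map.1 h1
    have h3 := ht.sum_eq m hm
    rw [h2, List.map_map] at h3
    exact (Nat.le_add_right _ _).trans h3.le
  have hgain : ∀ x, binAmount x t.2.2 = P.gain x := by
    intro x
    have h1 : binAmount x t.2.2 = ((t.2.2.map Prod.snd).map fun l =>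
        (l.map fun b => if b.1 = x.2 then x.1.gainAt b.2 else 0).sum).sum := by
      simp [binAmount, Function.comp_def]
    rw [h1, hP]
    simp [Placement.gain, Machine.gain, Function.comp_def, Block.size, Job.gainAt_succ]
  refine ⟨P.bundled u, enc_bundled u hP, (feasible_iff _).2 ⟨fun M hM => ?_, fun x hx => ?_⟩, ?_⟩
  · obtain ⟨e, he, hM⟩ := List.mem_flatMap.1 hM
    obtain ⟨M', hM', rfl⟩ := List.mem_map.1 he
    rw [(List.mem_replicate.1 hM).2]
    exact hfitP M' hM'
  · rw [gain_expand_bundled, ← hgain]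
    exact sound_table hb x hx
  · rw [cost_expand_bundled, ← hcost]
    refine Nat.mul_le_mul_left _ ?_
    have h1 := (hgood.2 s hs).count_le ht (hmax s hs)
    rw [hsr, rems, hrem, Multiset.coe_count, Multiset.coe_count] at h1
    have h2 := cost_add_count hfit'
    have h3 := cost_add_count hfitP
    have h4 : P.length = c * I.length := by
      rw [← ht.length_eq]; simpa using (congrArg List.length hP).symm
    omega

end

/-! ### The approximation ratio -/

section
variable {k : ℕ} {I : Packing (k + 1)}

theorem Packing.opt_le {k : ℕ} {I : Packing k} {P : Placement I.length k} (hP : I.Feasible P) :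
    I.opt ≤ P.cost := Nat.sInf_le ⟨P, hP, rfl⟩

theorem Packing.Solvable.exists_opt {k : ℕ} {I : Packing k} (h : I.Solvable) :
    ∃ P, I.Feasible P ∧ Placement.cost P = I.opt := by
  obtain ⟨P, hP⟩ := h
  exact Nat.sInf_mem (s := {m | ∃ P, I.Feasible P ∧ Placement.cost P = m}) ⟨_, P, hP, rfl⟩

/-- The number of full machines that satisfy the demand of a job. -/
def Job.fullCount (j : Job (k + 1)) : ℕ :=
  (j.target + j.gain (Fin.last k) - 1) / j.gain (Fin.last k)

theorem coarse_eq : coarse I = ∑ j : Fin I.length, (I.get j).fullCount := by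
  rw [coarse]
  conv_lhs => rw [← List.ofFn_get I, List.map_ofFn, List.sum_ofFn]
  rfl

theorem Job.fullCount_le {j : Job (k + 1)} {m : ℕ} (h : j.target ≤ m * j.gain (Fin.last k)) :
    j.fullCount ≤ m := by
  rw [Job.fullCount]
  -- Division by zero gives `fullCount = 0`.
  rcases Nat.eq_zero_or_pos (j.gain (Fin.last k)) with h0 | h0
  · simp [h0]
  · rw [← Nat.lt_add_one_iff, Nat.div_lt_iff_lt_mul h0, Nat.add_one_mul]
    omega

theorem Job.le_fullCount_mul {j : Job (k + 1)} (h : j.gain (Fin.last k) = 0 → j.target = 0) :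
    j.target ≤ j.fullCount * j.gain (Fin.last k) := by
  rcases Nat.eq_zero_or_pos (j.gain (Fin.last k)) with h0 | h0
  · simp [h h0]
  · have := Nat.lt_div_mul_add (a := j.target + j.gain (Fin.last k) - 1) h0
    rw [Job.fullCount]
    omega

theorem Placement.gain_le (P : Placement I.length (k + 1)) (j : Fin I.length) :
    P.gain (I.get j, j) ≤ (P.flatten.countP fun b => b.job = j) * (I.get j).gain (Fin.last k) := by
  rw [Placement.gain_eq, Multiset.map_coe, Multiset.sum_coe]
  generalize P.flatten = l
  induction l with
  | nil => simp
  | cons b l ih =>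
    rw [List.map_cons, List.sum_cons, List.countP_cons, add_mul, add_comm]
    refine add_le_add ih ?_
    simp only [Fin.val_inj, decide_eq_true_eq]
    split_ifs
    · simpa using (I.get j).gain_mono (Fin.le_last _)
    · simp

theorem sum_countP_job {n k : ℕ} (l : List (Block n k)) :
    ∑ j : Fin n, l.countP (fun b => b.job = j) = l.length := by
  induction l with
  | nil => simp
  | cons b l ih => simp [List.countP_cons, Finset.sum_add_distrib, ih]

theorem length_flatten_le {n k : ℕ} {P : Placement n k} (hP : ∀ M ∈ P, M.Fits) :
    P.flatten.length ≤ k * P.cost := by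
  induction P with
  | nil => simp
  | cons M P ih =>
    have h1 := ih fun M hM => hP M (List.mem_cons_of_mem _ hM)
    have h2 : Placement.cost (M :: P) = Placement.cost P + if !M.isEmpty then 1 else 0 := List.countP_cons
    have h3 := (Machine.length_le_sum M).trans (hP M (by simp))
    rw [h2, List.flatten_cons, List.length_append, mul_add]
    cases M with
    | nil => simpa using h1
    | cons b M =>
      simp only [List.isEmpty_cons, Bool.not_false, if_true, mul_one]
      omega

/-- No block yields more than a full machine, so each job has at least `fullCount` blocks, and a
machine holds at most `k + 1` blocks. -/
theorem coarse_le {P : Placement I.length (k + 1)} (hP : I.Feasible P) :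
    coarse I ≤ (k + 1) * P.cost := by
  refine le_trans ?_ (length_flatten_le hP.1)
  rw [coarse_eq, ← sum_countP_job]
  refine Finset.sum_le_sum fun j _ => Job.fullCount_le ?_
  exact ((target_le_iff P j).2 (hP.2 j)).trans (P.gain_le j)

/-- Giving every job `fullCount` machines of its own is feasible. Solvability excludes a positive
demand for which even a full machine yields nothing. -/
theorem opt_le_coarse (h : I.Solvable) : I.opt ≤ coarse I := by
  obtain ⟨P, hP⟩ := h
  set Q : Placement I.length (k + 1) := (List.finRange I.length).flatMap fun j =>
    List.replicate (I.get j).fullCount [⟨j, Fin.last k⟩] with hQ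
  have hQf : I.Feasible Q := by
    refine ⟨fun M hM => ?_, fun j => (target_le_iff Q j).1 ?_⟩
    · obtain ⟨j, -, hM⟩ := List.mem_flatMap.1 hM
      rw [(List.mem_replicate.1 hM).2]
      simp [Machine.Fits, Block.size]
    · refine (Job.le_fullCount_mul fun h0 => ?_).trans ?_
      · have := ((target_le_iff P j).2 (hP.2 j)).trans (P.gain_le j)
        rw [h0] at this
        omega
      · have h1 : Q.gain (I.get j, j) = ((List.finRange I.length).map fun i =>
            if i = j then (I.get j).fullCount * (I.get j).gain (Fin.last k) else 0).sum := by
          rw [Placement.gain, hQ, List.flatMap_def, List.map_flatten, List.sum_flatten, List.map_map,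
            List.map_map]
          congr 2
          funext i
          simp only [Function.comp, List.map_replicate, List.sum_replicate]
          simp only [Machine.gain, List.map_cons, List.map_nil, List.sum_singleton, Fin.val_inj]
          split_ifs with hij
          · rw [hij]; rfl
          · simp
        rw [h1]
        refine List.single_le_sum (by simp) _ (List.mem_map.2 ⟨j, by simp, by simp⟩)
  refine (Packing.opt_le hQf).trans ((List.countP_le_length).trans ?_)
  rw [coarse_eq, hQ, List.length_flatMap]
  simp [← List.sum_ofFn, List.ofFn_eq_map]

/-- With `c = 2 * E + C + (k + 1)` the table has room for the rounded optimum: `opt ≤ coarse < (u +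
1) * E * n ≤ 2 * u * E * n`, and rounding adds at most `(C + (k + 1)) * n` bundles. The condition on
`E` makes these additional bundles cost at most `ε * opt`. -/
theorem scheme_spec {ε : ℝ} {E : ℕ} (hE : 0 < E)
    (hE' : ((shapeCount (k + 1) + (k + 1)) * (k + 1) : ℕ) ≤ ε * E) (h : I.Solvable) :
    ∃ S : Schedule I.length (k + 1),
      Enc.enc (scheme E (2 * E + shapeCount (k + 1) + (k + 1)) I) = S.encode ∧
      I.Feasible S.expand ∧ (Placement.cost S.expand : ℝ) ≤ (1 + ε) * (I.opt : ℝ) := by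
  set C := shapeCount (k + 1)
  obtain ⟨P₀, hP₀, hopt⟩ := h.exists_opt
  obtain ⟨hfit₀, hd₀⟩ := (feasible_iff P₀).1 hP₀
  -- Rounding counts all machines, the cost only the nonempty ones, so empty machines are removed.
  set P : Placement I.length (k + 1) := P₀.filter fun M => !M.isEmpty with hP
  have hPlen : P.length = I.opt := by rw [hP, Placement.length_filter, hopt]
  have hfit : ∀ M ∈ P, M.Fits := fun M hM => hfit₀ M (List.mem_filter.1 hM).1
  have hd : ∀ x ∈ I.zipIdx, x.1.target ≤ P.gain x := fun x hx => by
    have := hd₀ x hx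
    rwa [Placement.gain_eq, hP, Placement.flatten_filter, ← Placement.gain_eq]
  have hN := opt_le_coarse h
  have hN' : coarse I ≤ (k + 1) * I.opt := hopt ▸ coarse_le hP₀
  have hε : 0 ≤ ε := by
    by_contra! h0
    have : ε * E < 0 := mul_neg_of_neg_of_pos h0 (by exact_mod_cast hE)
    have := (Nat.cast_nonneg (α := ℝ) _).trans hE'
    linarith
  -- Here the optimum itself fits into the table, so no rounding is needed.
  by_cases h0 : coarse I / (E * I.length) = 0
  · have hu : bundle E I = 1 := if_pos h0
    rw [scheme, hu]
    have hlen : P.length ≤ (2 * E + C + (k + 1)) * I.length := by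
      rw [hPlen]
      refine hN.trans ?_
      rcases Nat.eq_zero_or_pos I.length with hn | hn
      · rw [List.length_eq_zero_iff.1 hn]; simp [coarse]
      · have := (Nat.div_eq_zero_iff_lt (Nat.mul_pos hE hn)).1 h0
        nlinarith
    obtain ⟨S, h1, h2, h3⟩ := best_table hlen hfit (u := 1) (by simpa using hd)
    refine ⟨S, h1, h2, ?_⟩
    have h4 : Placement.cost S.expand ≤ I.opt := by
      rw [← hPlen]
      refine h3.trans ?_
      rw [one_mul]
      exact List.countP_le_length
    have h5 : (Placement.cost S.expand : ℝ) ≤ I.opt := by exact_mod_cast h4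
    have : 0 ≤ ε * (I.opt : ℝ) := by positivity
    linarith
  · have hu : bundle E I = coarse I / (E * I.length) := if_neg h0
    rw [scheme, hu]
    set u := coarse I / (E * I.length)
    have hu0 : 0 < u := Nat.pos_of_ne_zero h0
    have hn : 0 < I.length := by
      by_contra! hn
      simp [u, Nat.le_zero.1 hn] at hu0
    obtain ⟨Q, hQfit, hQle, hQlen⟩ := exists_rounding P hfit hu0
    rw [hPlen] at hQlen
    have hEn : u * (E * I.length) ≤ coarse I := Nat.div_mul_le_self _ _
    have hlt : coarse I < u * (E * I.length) + E * I.length :=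
      Nat.lt_div_mul_add (Nat.mul_pos hE hn)
    have hlen : Q.length ≤ (2 * E + C + (k + 1)) * I.length := by
      refine Nat.le_of_mul_le_mul_left (hQlen.trans ?_) hu0
      have h1 : E * I.length ≤ u * (E * I.length) := Nat.le_mul_of_pos_left _ hu0
      have h2 : C * u ≤ C * u * I.length := Nat.le_mul_of_pos_right _ hn
      calc I.opt + (C + I.length * (k + 1)) * u
          ≤ 2 * (u * (E * I.length)) + (C * u * I.length + I.length * (k + 1) * u) := by
            rw [add_mul]; omega
        _ = u * ((2 * E + C + (k + 1)) * I.length) := by ring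
    obtain ⟨S, h1, h2, h3⟩ := best_table hlen hQfit (u := u) fun x hx =>
      (hd x hx).trans (Placement.gain_le_of_le hQle x)
    refine ⟨S, h1, h2, ?_⟩
    have h4 : Placement.cost S.expand ≤ I.opt + (C + (k + 1)) * (I.length * u) := by
      refine h3.trans ((Nat.mul_le_mul_left _ List.countP_le_length).trans (hQlen.trans ?_))
      have h5 : C * u ≤ C * (I.length * u) :=
        Nat.mul_le_mul_left _ (Nat.le_mul_of_pos_left _ hn)
      calc I.opt + (C + I.length * (k + 1)) * u
          ≤ I.opt + (C * (I.length * u) + I.length * (k + 1) * u) := by rw [add_mul]; omega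
        _ = _ := by ring
    have h5 : E * (I.length * u) ≤ (k + 1) * I.opt := by
      refine le_trans (le_of_eq ?_) (hEn.trans hN')
      ring
    have hE0 : (0 : ℝ) < E := by exact_mod_cast hE
    have h6 : (E : ℝ) * (I.length * u) ≤ (k + 1) * I.opt := by exact_mod_cast h5
    have h7 : (Placement.cost S.expand : ℝ) ≤ I.opt + (C + (k + 1)) * (I.length * u) := by
      exact_mod_cast h4
    push_cast at hE'
    have h8 : ((C : ℝ) + (k + 1)) * (I.length * u) ≤ ε * I.opt := by
      refine le_of_mul_le_mul_left ?_ hE0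
      calc (E : ℝ) * ((C + (k + 1)) * (I.length * u)) = (C + (k + 1)) * (E * (I.length * u)) := by ring
        _ ≤ (C + (k + 1)) * ((k + 1) * I.opt) := by gcongr
        _ = ((C + (k + 1)) * (k + 1)) * I.opt := by ring
        _ ≤ (ε * E) * I.opt := by gcongr
        _ = E * (ε * I.opt) := by ring
    linarith

end

/-- Without processors there are no blocks, so solvability forces all demands to vanish. The case is
separate because the scheme needs a largest block size. -/
theorem isPolyTimeApprox_zero (r : ℝ) : IsPolyTimeApprox 0 r (.op (.const 0)) := by
  refine ⟨Polynomial.X + 1, fun I => ⟨.atom 0, _, .op (.const 0) I.encode, ?_, fun h => ?_⟩⟩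
  · simp [Op.apply, Data.size]
  · obtain ⟨P, hP⟩ := h
    have h1 : I.Feasible [] := by
      refine ⟨by simp, fun j => (hP.2 j).trans (le_of_eq ?_)⟩
      have : ∀ M : Machine I.length 0, M = [] := fun M => by
        cases M with
        | nil => rfl
        | cons b _ => exact b.idx.elim0
      simp [Packing.amount, this]
    have h2 : I.opt = 0 := Nat.le_zero.1 (Packing.opt_le h1)
    exact ⟨[], rfl, h1, by simp [h2, Schedule.expand, Placement.cost]⟩

end ServerPlacement

theorem mainTheorem4 (k : ℕ) (ε : ℝ) (hε : 0 < ε) :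
    ∃ p : ServerPlacement.Prog, ServerPlacement.IsPolyTimeApprox k (1 + ε) p := by
  open ServerPlacement in
  rcases k with _ | k
  · exact ⟨_, isPolyTimeApprox_zero _⟩
  · obtain ⟨E, hE⟩ := exists_nat_gt (((shapeCount (k + 1) + (k + 1)) * (k + 1) : ℕ) / ε)
    have hE0 : 0 < E := by
      have : (0 : ℝ) < E := lt_of_le_of_lt (by positivity) hE
      exact_mod_cast this
    rw [div_lt_iff₀' hε] at hE
    obtain ⟨p, q, hp⟩ := PT.scheme (k := k) E (2 * E + shapeCount (k + 1) + (k + 1))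
    refine ⟨p, q, fun I => ?_⟩
    obtain ⟨t, ht, hq⟩ := hp I
    exact ⟨_, t, ht, hq, scheme_spec hE0 hE.le⟩
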